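/- Let $p>1$ be real and let $k\ge r\ge 3$ be integers. An $r$-graph $H$ is a finite vertex set $V(H)$ with a set $E(H)$ of $r$-element subsets of $V(H)$. For an $r$-graph $H$ on $n\ge 1$ vertices put $$\lambda^{(p)}(H)=\max\Big\{\,r!\sum_{e\in E(H)}\prod_{v\in e}x_v \;:\; x\in\mathbb{R}^{V(H)},\ \Big(\sum_{v\in V(H)}|x_v|^p\Big)^{1/p}=1\Big\}.$$ Let $F_{k+1}^{(r)}$ be the $r$-graph whose edges are $[r]=\{1,\dots,r\}$ and $\{i,j\}\cup E_{ij}$ for all pairs $\{i,j\}\subseteq[k+1]$ with $\{i,j\}\not\subseteq[r]$, where the $E_{ij}$ are pairwise disjoint $(r-2)$-sets disjoint from $[k+1]$. An $r$-graph is $F_{k+1}^{(r)}$-free if it has no (not necessarily induced) subgraph isomorphic to $F_{k+1}^{(r)}$. Let $T_r(n,k)$ be the $r$-graph on $n$ vertices whose vertex set is partitioned into $k$ parts with sizes pairwise differing by at most one, and whose edges are all $r$-sets containing at most one vertex from each part. Write $(k)_r=k(k-1)\cdots(k-r+1)$. **Theorem.** For every $\varepsilon>0$ there are $\delta>0$ and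 $n_0$, depending only on $p,k,r,\varepsilon$, such that the following holds for all $n>n_0$: if $H$ is an $n$-vertex $F_{k+1}^{(r)}$-free $r$-graph with $$\lambda^{(p)}(H)>(1-\delta)\,\frac{(k)_r}{k^r}\,n^{r(1-1/p)},$$ then $H$ can be transformed into a copy of $T_r(n,k)$ on the same vertex set by adding and deleting at most $\varepsilon\binom{n}{r}$ edges in total. -/

import Mathlib

open scoped symmDiff Nat

/-- An `r`-uniform hypergraph (`r`-graph) with vertex set `V`: a finite collection of
`r`-element subsets of `V`. -/
structure RGraph (V : Type*) (r : ℕ) where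
  /-- The edge set. -/
  edges : Finset (Finset V)
  /-- Every edge has exactly `r` vertices. -/
  card_of_mem : ∀ e ∈ edges, e.card = r

namespace RGraph

/-- `H` contains a copy of `F` as a (not necessarily induced) subgraph: some injection of the
vertices of `F` into those of `H` maps every edge of `F` to an edge of `H`. -/
def Contains {V W : Type*} {r : ℕ} (H : RGraph V r) (F : RGraph W r) : Prop :=
  ∃ f : W ↪ V, ∀ e ∈ F.edges, e.map f ∈ H.edges

/-- `H` is `F`-free. -/
def Free {V W : Type*} {r : ℕ} (F : RGraph W r) (H : RGraph V r) : Prop :=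
  ¬ H.Contains F

/-- The `ℓ^p` norm `(∑ |x_v|^p)^(1/p)` of a real vector indexed by a finite set. -/
noncomputable def pNorm {V : Type*} [Fintype V] (p : ℝ) (x : V → ℝ) : ℝ :=
  (∑ v, |x v| ^ p) ^ (1 / p)

/-- The polynomial form `P_H(x) = r! ∑_{e ∈ E(H)} ∏_{v ∈ e} x_v`. -/
noncomputable def polyForm {V : Type*} {r : ℕ} (H : RGraph V r) (x : V → ℝ) : ℝ :=
  (r ! : ℝ) * ∑ e ∈ H.edges, ∏ v ∈ e, x v

/-- The `p`-spectral radius: the maximum of `P_H(x)` over all real `x` with `‖x‖_p = 1`.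
The supremum is attained, see `isGreatest_pSpectralRadius`. -/
noncomputable def pSpectralRadius {V : Type*} [Fintype V] {r : ℕ} (p : ℝ) (H : RGraph V r) : ℝ :=
  sSup (H.polyForm '' {x : V → ℝ | pNorm p x = 1})

theorem isGreatest_pSpectralRadius {V : Type*} [Fintype V] [Nonempty V] {r : ℕ} {p : ℝ}
    (hp : 1 ≤ p) (H : RGraph V r) :
    IsGreatest (H.polyForm '' {x : V → ℝ | pNorm p x = 1}) (H.pSpectralRadius p) := by
  classical
  have hp0 : 0 < p := by linarith
  have hnn : ∀ x : V → ℝ, 0 ≤ ∑ v, |x v| ^ p := fun x =>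
    Finset.sum_nonneg fun v _ => Real.rpow_nonneg (abs_nonneg _) _
  have hset : {x : V → ℝ | pNorm p x = 1} = {x : V → ℝ | ∑ v, |x v| ^ p = 1} := by
    ext x
    simp only [pNorm, Set.mem_ofPred_eq]
    have h := Real.rpow_left_inj (hnn x) zero_le_one (one_div_pos.mpr hp0).ne'
    rwa [Real.one_rpow] at h
  have hclosed : IsClosed {x : V → ℝ | ∑ v, |x v| ^ p = 1} := by
    refine isClosed_eq (continuous_finsetSum _ fun v _ => ?_) continuous_const
    exact ((continuous_apply v).abs).rpow_const fun _ => Or.inr hp0.le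
  have hcpt : IsCompact {x : V → ℝ | ∑ v, |x v| ^ p = 1} := by
    refine Metric.isCompact_of_isClosed_isBounded hclosed ?_
    refine (Metric.isBounded_closedBall (x := (0 : V → ℝ)) (r := 1)).subset ?_
    intro x hx
    rw [mem_closedBall_zero_iff, pi_norm_le_iff_of_nonneg zero_le_one]
    intro v
    have h1 : |x v| ^ p ≤ 1 := by
      rw [← (show ∑ v, |x v| ^ p = 1 from hx)]
      exact Finset.single_le_sum (f := fun v => |x v| ^ p)
        (fun w _ => Real.rpow_nonneg (abs_nonneg _) _) (Finset.mem_univ v)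
    rw [Real.norm_eq_abs]
    by_contra h
    exact absurd (Real.one_lt_rpow (not_le.mp h) hp0) (not_lt.mpr h1)
  have hne : {x : V → ℝ | ∑ v, |x v| ^ p = 1}.Nonempty := by
    obtain ⟨v₀⟩ := ‹Nonempty V›
    refine ⟨Pi.single v₀ 1, ?_⟩
    rw [Set.mem_ofPred_eq, Finset.sum_eq_single v₀]
    · simp
    · intro w _ hw
      simp [Pi.single_eq_of_ne hw, Real.zero_rpow hp0.ne']
    · simp
  have hcont : Continuous H.polyForm := by
    unfold polyForm
    fun_prop
  rw [pSpectralRadius, hset]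
  exact (hcpt.image hcont).isGreatest_sSup (hne.image _)

/-- `T` is (a copy of) the Turán `r`-graph `T_r(n, k)` on its vertex set `V`, `n = |V|`: there is a
partition of `V` into `k` parts (the fibres of `c`) whose sizes pairwise differ by at most one, and
the edges are exactly the `r`-sets with at most one vertex in each part. -/
def IsTuran {V : Type*} [Fintype V] {r : ℕ} (k : ℕ) (T : RGraph V r) : Prop :=
  ∃ c : V → Fin k,
    (∀ i j : Fin k, Nat.card {v // c v = i} ≤ Nat.card {v // c v = j} + 1) ∧
    ∀ e : Finset V, e ∈ T.edges ↔ e.card = r ∧ Set.InjOn c e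

/-- `H` can be transformed to the Turán `r`-graph `T_r(n, k)` by adding and deleting at most `m`
edges in total. -/
def IsCloseToTuran {V : Type*} [Fintype V] [DecidableEq V] {r : ℕ} (k : ℕ) (m : ℝ)
    (H : RGraph V r) : Prop :=
  ∃ T : RGraph V r, T.IsTuran k ∧ ((H.edges ∆ T.edges).card : ℝ) ≤ m

/-- The pairs `{i, j}` of core vertices `0, …, t - 1` that do not lie inside the set of the first
`r` core vertices. -/
abbrev FanPair (r t : ℕ) : Type :=
  {s : Finset (Fin t) // s.card = 2 ∧ ¬ ∀ i ∈ s, (i : ℕ) < r}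

/-- The vertices of `F_t^{(r)}`: the `t` core vertices, and `r - 2` private new vertices for each
pair in `FanPair r t`. -/
abbrev FanVertex (r t : ℕ) : Type :=
  Fin t ⊕ (FanPair r t × Fin (r - 2))

/-- The generalized fan `F_t^{(r)}`, for `2 ≤ r ≤ t`: its edges are the set of the first `r` core
vertices, and, for each pair in `FanPair r t`, that pair together with its `r - 2` private
vertices. -/
def generalizedFan (r t : ℕ) (hr : 2 ≤ r) (ht : r ≤ t) : RGraph (FanVertex r t) r where
  edges :=
    insert ((Finset.univ.filter fun i : Fin t => (i : ℕ) < r).disjSum ∅)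
      (Finset.univ.image fun q : FanPair r t =>
        q.1.disjSum (({q} : Finset (FanPair r t)) ×ˢ (Finset.univ : Finset (Fin (r - 2)))))
  card_of_mem := by
    intro e he
    rw [Finset.mem_insert, Finset.mem_image] at he
    rcases he with rfl | ⟨q, -, rfl⟩
    · rw [Finset.card_disjSum, Finset.card_empty, add_zero, Fin.card_filter_val_lt]
      exact min_eq_right ht
    · rw [Finset.card_disjSum, Finset.card_product, q.2.1]
      simp only [Finset.card_singleton, Finset.card_univ, Fintype.card_fin]
      omega

end RGraph

/-!
The extremal problem for the generalized fan is local: call a pair of vertices robustly covered if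
it lies in edges avoiding any given bounded set of further vertices. All but `O(n ^ (r - 1))` edges
have all their pairs robustly covered (`card_sdiff_robustPart_le`), and if `H` contains no fan, then
the family `E` of these edges has the property `EdgeCliqueBounded k E`: a clique of the cover graph
(the graph of all pairs inside edges) containing an edge has at most `k` vertices. Otherwise `k + 1`
of its vertices are the core of a fan whose private vertices are chosen greedily
(`edgeCliqueBounded_robustPart`).

This property gives the Motzkin–Straus bound `∑ e ∈ E, ∏ v ∈ e, x v ≤ C(k, r) / k ^ r` for
nonnegative weights of sum `1`: moving weight between vertices that are not adjacent in the cover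
graph makes the support a clique (`EdgeCliqueBounded.sum_prod_le`). Applying Hölder's inequality
to the weights `|x v| ^ p` bounds the spectral radius by a constant times the power `1 - 1 / p` of
the number of edges; since `1 < p`, a nearly maximal spectral radius forces `E` to have nearly
`C(k, r) (n / k) ^ r` edges (`card_ge_of_lt_pSpectralRadius`).

It remains to see that such an `E` is nearly complete `k`-partite. Restricting to a set `U` of
almost all vertices, all degrees may be assumed to be nearly maximal. The links of vertices satisfy
the same property with `k - 1` in place of `k`, so a vertex of large degree has at least about
`(1 - 1 / k) * #U` neighbours in the cover graph. Hence each edge extends to a clique with `k`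
vertices; the sets of non-neighbours of these have size at most about `#U / k` and cover `U`, so
they are almost disjoint. Thus adjacent vertices have almost disjoint sets of non-neighbours. The sets of
non-neighbours of the vertices of one fixed `k`-clique are the parts: two vertices in the same part
share most of it as non-neighbours, so they are not adjacent (`EdgeCliqueBounded.exists_coloring`).
Finally the parts are made balanced by recolouring few vertices.
-/

namespace RGraph

open Finset

variable {V : Type*}

/-! ### The Lagrangian bound -/

/-- The graph of `y ↦ y ^ (r + 1)` lies above its tangent line at `a`. -/
theorem pow_add_mul_sub_mul_pow_le {a y : ℝ} (ha : 0 ≤ a) (hy : 0 ≤ y) (r : ℕ) :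
    a ^ (r + 1) + (r + 1) * (y - a) * a ^ r ≤ y ^ (r + 1) := by
  induction r with
  | zero => simp
  | succ r ih =>
    have h1 := mul_le_mul_of_nonneg_left ih hy
    have h2 : 0 ≤ ((r : ℝ) + 1) * (y - a) ^ 2 * a ^ r := by positivity
    push_cast
    calc _ = y * (a ^ (r + 1) + (r + 1) * (y - a) * a ^ r)
          - ((r : ℝ) + 1) * (y - a) ^ 2 * a ^ r := by ring
      _ ≤ y * y ^ (r + 1) := by linarith
      _ = _ := by ring

/-- The numerical step of Maclaurin's inequality: `a` is the mean of `k` numbers, and `y` is the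
mean after adding the further number `(k + 1) * y - k * a`. -/
theorem choose_mul_pow_add_le (k r : ℕ) {a y : ℝ} (ha : 0 ≤ a) (hy : 0 ≤ y) :
    (k.choose (r + 1) : ℝ) * a ^ (r + 1) + ((k + 1) * y - k * a) * (k.choose r * a ^ r) ≤
      ((k + 1).choose (r + 1) : ℝ) * y ^ (r + 1) := by
  have h1 : ((k : ℝ) + 1) * k.choose r = (k + 1).choose (r + 1) * (r + 1) := by
    exact_mod_cast Nat.add_one_mul_choose_eq k r
  have h2 : ((k + 1).choose (r + 1) : ℝ) = k.choose r + k.choose (r + 1) := by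
    exact_mod_cast Nat.choose_succ_succ k r
  have h3 := mul_le_mul_of_nonneg_left (pow_add_mul_sub_mul_pow_le ha hy r)
    (Nat.cast_nonneg (α := ℝ) ((k + 1).choose (r + 1)))
  refine le_trans (le_of_eq ?_) h3
  have h4 : (k.choose (r + 1) : ℝ) = (k + 1).choose (r + 1) - k.choose r := by linarith
  rw [h4]
  linear_combination (a ^ r * (y - a)) * h1

theorem choose_mul_div_pow_mono {j k : ℕ} (hj : 0 < j) (hjk : j ≤ k) (r : ℕ) {S : ℝ}
    (hS : 0 ≤ S) :
    (j.choose r : ℝ) * (S / j) ^ r ≤ k.choose r * (S / k) ^ r := by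
  induction k, hjk using Nat.le_induction with
  | base => exact le_rfl
  | succ k hk ih =>
    refine ih.trans ?_
    cases r with
    | zero => simp
    | succ r =>
      have hk0 : (k : ℝ) ≠ 0 := by exact_mod_cast (show k ≠ 0 by omega)
      have h := choose_mul_pow_add_le k r (a := S / k) (y := S / (k + 1)) (by positivity)
        (by positivity)
      have h0 : ((k : ℝ) + 1) * (S / (k + 1)) - k * (S / k) = 0 := by
        field_simp
        ring
      rw [h0, zero_mul, add_zero] at h
      exact_mod_cast h

/-- **Maclaurin's inequality** between the `r`-th elementary symmetric polynomial and the mean. -/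
theorem sum_powersetCard_prod_le [DecidableEq V] (s : Finset V) (x : V → ℝ) (hx : ∀ v, 0 ≤ x v)
    (r : ℕ) :
    ∑ e ∈ s.powersetCard r, ∏ v ∈ e, x v ≤ (#s).choose r * ((∑ v ∈ s, x v) / #s) ^ r := by
  induction s using Finset.induction_on generalizing r with
  | empty =>
    cases r with
    | zero => simp
    | succ r => rw [powersetCard_eq_empty.2 (by simp)]; simp
  | insert v s hv ih =>
    cases r with
    | zero => simp
    | succ r =>
      have hsum : ∑ e ∈ (insert v s).powersetCard (r + 1), ∏ w ∈ e, x w =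
          ∑ e ∈ s.powersetCard (r + 1), ∏ w ∈ e, x w +
            x v * ∑ e ∈ s.powersetCard r, ∏ w ∈ e, x w := by
        have hmem : ∀ e ∈ s.powersetCard r, v ∉ e := fun e he hve =>
          hv ((mem_powersetCard.1 he).1 hve)
        rw [powersetCard_succ_insert hv, sum_union, sum_image, mul_sum]
        · congr 1
          exact sum_congr rfl fun e he => prod_insert (hmem e he)
        · intro e he f hf hef
          rw [← erase_insert (hmem e he), ← erase_insert (hmem f hf), hef]
        · rw [disjoint_left]
          intro e he hf
          obtain ⟨f, -, rfl⟩ := mem_image.1 hf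
          exact hv ((mem_powersetCard.1 he).1 (mem_insert_self v f))
      have hS : 0 ≤ ∑ w ∈ s, x w := sum_nonneg fun w _ => hx w
      set S := ∑ w ∈ s, x w with hSdef
      have h := choose_mul_pow_add_le (#s) r (a := S / #s) (y := (x v + S) / (#s + 1))
        (by positivity) (by have := hx v; positivity)
      have hk : (#s : ℝ) * (S / #s) = S := by
        rcases eq_or_ne (#s) 0 with h0 | h0
        · have : S = 0 := by rw [hSdef, card_eq_zero.1 h0, sum_empty]
          simp [this]
        · field_simp
      have hxv : ((#s : ℝ) + 1) * ((x v + S) / (#s + 1)) - #s * (S / #s) = x v := by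
        rw [hk]; field_simp; ring
      rw [hxv] at h
      rw [hsum, card_insert_of_notMem hv, sum_insert hv, Nat.cast_add_one]
      exact (add_le_add (ih (r + 1)) (mul_le_mul_of_nonneg_left (ih r) (hx v))).trans h

/-- The graph joining two distinct vertices that lie in a common member of `E` (the shadow on
pairs). -/
def coverGraph (E : Finset (Finset V)) : SimpleGraph V where
  Adj u v := u ≠ v ∧ ∃ e ∈ E, u ∈ e ∧ v ∈ e
  symm := ⟨fun _ _ h => ⟨h.1.symm, by obtain ⟨e, he, hu, hv⟩ := h.2; exact ⟨e, he, hv, hu⟩⟩⟩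
  loopless := ⟨fun _ h => h.1 rfl⟩

/-- Every clique of the cover graph that contains a member of `E` has at most `k` vertices. -/
def EdgeCliqueBounded (k : ℕ) (E : Finset (Finset V)) : Prop :=
  ∀ e ∈ E, ∀ Q : Finset V, e ⊆ Q → (coverGraph E).IsClique (Q : Set V) → #Q ≤ k

theorem coverGraph_mono {E F : Finset (Finset V)} (h : E ⊆ F) : coverGraph E ≤ coverGraph F :=
  fun _ _ ⟨hne, e, he, hu⟩ => ⟨hne, e, h he, hu⟩

theorem EdgeCliqueBounded.mono {k : ℕ} {E F : Finset (Finset V)} (h : EdgeCliqueBounded k F)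
    (hEF : E ⊆ F) : EdgeCliqueBounded k E :=
  fun e he Q heQ hQ => h e (hEF he) Q heQ (hQ.mono (coverGraph_mono hEF))

/-- Moving all the weight of `v` to a vertex `u` not covered together with `v` does not decrease
the weight polynomial, if its partial derivative at `u` is at least that at `v`. -/
theorem sum_prod_le_sum_prod_update [DecidableEq V] {E : Finset (Finset V)} {s : Finset V} {u v : V}
    (hcov : ∀ e ∈ E, u ∈ e → v ∉ e) {x : V → ℝ} (hx : ∀ w, 0 ≤ x w)
    (hle : ∑ e ∈ E with e ⊆ s ∧ v ∈ e, ∏ w ∈ e.erase v, x w ≤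
      ∑ e ∈ E with e ⊆ s ∧ u ∈ e, ∏ w ∈ e.erase u, x w) :
    ∑ e ∈ E with e ⊆ s, ∏ w ∈ e, x w ≤
      ∑ e ∈ E with e ⊆ s.erase v, ∏ w ∈ e, Function.update x u (x u + x v) w := by
  have hsplit : ∀ y : V → ℝ, ∑ e ∈ E with e ⊆ s.erase v, ∏ w ∈ e, y w =
      y u * ∑ e ∈ E with e ⊆ s ∧ u ∈ e, ∏ w ∈ e.erase u, y w +
        ∑ e ∈ E with e ⊆ s.erase v ∧ u ∉ e, ∏ w ∈ e, y w := by
    intro y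
    rw [← sum_filter_add_sum_filter_not _ (fun e => u ∈ e), filter_filter, filter_filter, mul_sum]
    congr 1
    have : {e ∈ E | e ⊆ s.erase v ∧ u ∈ e} = {e ∈ E | e ⊆ s ∧ u ∈ e} := by
      refine filter_congr fun e he => ?_
      rw [subset_erase]
      exact ⟨fun h => ⟨h.1.1, h.2⟩, fun h => ⟨⟨h.1, hcov e he h.2⟩, h.2⟩⟩
    rw [this]
    refine sum_congr rfl fun e he => ?_
    rw [mul_prod_erase _ _ (mem_filter.1 he).2.2]
  have h1 : ∑ e ∈ E with e ⊆ s, ∏ w ∈ e, x w =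
      x v * ∑ e ∈ E with e ⊆ s ∧ v ∈ e, ∏ w ∈ e.erase v, x w +
        ∑ e ∈ E with e ⊆ s.erase v, ∏ w ∈ e, x w := by
    rw [← sum_filter_add_sum_filter_not _ (fun e => v ∈ e), filter_filter, filter_filter, mul_sum]
    congr 1
    · refine sum_congr rfl fun e he => ?_
      rw [mul_prod_erase _ _ (mem_filter.1 he).2.2]
    · refine sum_congr (filter_congr fun e _ => ?_) fun _ _ => rfl
      rw [subset_erase]
  have h2 : ∑ e ∈ E with e ⊆ s ∧ u ∈ e, ∏ w ∈ e.erase u, Function.update x u (x u + x v) w =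
      ∑ e ∈ E with e ⊆ s ∧ u ∈ e, ∏ w ∈ e.erase u, x w :=
    sum_congr rfl fun e _ => prod_congr rfl fun w hw =>
      Function.update_of_ne (ne_of_mem_erase hw) _ _
  have h3 : ∑ e ∈ E with e ⊆ s.erase v ∧ u ∉ e, ∏ w ∈ e, Function.update x u (x u + x v) w =
      ∑ e ∈ E with e ⊆ s.erase v ∧ u ∉ e, ∏ w ∈ e, x w :=
    sum_congr rfl fun e he => prod_congr rfl fun w hw =>
      Function.update_of_ne (ne_of_mem_of_not_mem hw (mem_filter.1 he).2.2) _ _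
  rw [h1, hsplit x, hsplit (Function.update x u (x u + x v)), h2, h3, Function.update_self]
  have := mul_le_mul_of_nonneg_left hle (hx v)
  linarith

/-- **Motzkin–Straus bound.** Weight is moved between vertices not covered together until the
support is a clique of the cover graph; a clique carrying positive weight has at most `k`
vertices, and Maclaurin's inequality applies. -/
theorem EdgeCliqueBounded.sum_prod_le [DecidableEq V] {k r : ℕ} {E : Finset (Finset V)}
    (hE : EdgeCliqueBounded k E) (hr : ∀ e ∈ E, #e = r) (s : Finset V) (x : V → ℝ)
    (hx : ∀ v, 0 ≤ x v) :
    ∑ e ∈ E with e ⊆ s, ∏ v ∈ e, x v ≤ k.choose r * ((∑ v ∈ s, x v) / k) ^ r := by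
  induction hn : #s using Nat.strong_induction_on generalizing s x with
  | _ n ih =>
  have hshift : ∀ u ∈ s, ∀ v ∈ s, u ≠ v → (∀ e ∈ E, u ∈ e → v ∉ e) →
      ∑ e ∈ E with e ⊆ s ∧ v ∈ e, ∏ w ∈ e.erase v, x w ≤
        ∑ e ∈ E with e ⊆ s ∧ u ∈ e, ∏ w ∈ e.erase u, x w →
      ∑ e ∈ E with e ⊆ s, ∏ v ∈ e, x v ≤ k.choose r * ((∑ v ∈ s, x v) / k) ^ r := by
    intro u hu v hv huv hcov hle
    have h1 := ih _ (hn ▸ card_erase_lt_of_mem hv) (s.erase v)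
      (Function.update x u (x u + x v)) (fun w => by
        rcases eq_or_ne w u with rfl | hw
        · rw [Function.update_self]; exact add_nonneg (hx _) (hx _)
        · rw [Function.update_of_ne hw]; exact hx w) rfl
    have h2 : ∑ w ∈ s.erase v, Function.update x u (x u + x v) w = ∑ w ∈ s, x w := by
      rw [sum_update_of_mem (mem_erase.2 ⟨huv, hu⟩), ← add_sum_erase s x hv,
        ← add_sum_erase (s.erase v) x (mem_erase.2 ⟨huv, hu⟩), sdiff_singleton_eq_erase]
      ring
    rw [h2] at h1
    exact (sum_prod_le_sum_prod_update hcov hx hle).trans h1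
  by_cases hclique : (coverGraph E).IsClique (s : Set V)
  · by_cases hedge : ∃ e ∈ E, e ⊆ s
    · obtain ⟨e, he, hes⟩ := hedge
      have hsk : #s ≤ k := hE e he s hes hclique
      have hS : 0 ≤ ∑ v ∈ s, x v := sum_nonneg fun v _ => hx v
      rcases s.eq_empty_or_nonempty with rfl | hne
      · have hr0 : r = 0 := by rw [← hr e he, subset_empty.1 hes, card_empty]
        subst hr0
        have : {e ∈ E | e ⊆ ∅} ⊆ {∅} := fun f hf => by
          rw [mem_singleton]; exact subset_empty.1 (mem_filter.1 hf).2
        refine (sum_le_sum_of_subset_of_nonneg this fun f _ _ =>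
          prod_nonneg fun v _ => hx v).trans ?_
        simp
      · refine le_trans ?_ (choose_mul_div_pow_mono (card_pos.2 hne) hsk r hS)
        refine le_trans ?_ (sum_powersetCard_prod_le s x hx r)
        refine sum_le_sum_of_subset_of_nonneg (fun f hf => ?_)
          fun f _ _ => prod_nonneg fun v _ => hx v
        rw [mem_filter] at hf
        exact mem_powersetCard.2 ⟨hf.2, hr f hf.1⟩
    · have : {e ∈ E | e ⊆ s} = ∅ := by
        rw [filter_eq_empty_iff]
        exact fun e he hes => hedge ⟨e, he, hes⟩
      rw [this, sum_empty]
      have hS : 0 ≤ ∑ v ∈ s, x v := sum_nonneg fun v _ => hx v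
      positivity
  · rw [SimpleGraph.isClique_iff, Set.Pairwise] at hclique
    push Not at hclique
    obtain ⟨u, hu, v, hv, huv, hadj⟩ := hclique
    have hcov : ∀ e ∈ E, u ∈ e → v ∉ e := fun e he hue hve => hadj ⟨huv, e, he, hue, hve⟩
    rcases le_total (∑ e ∈ E with e ⊆ s ∧ v ∈ e, ∏ w ∈ e.erase v, x w)
      (∑ e ∈ E with e ⊆ s ∧ u ∈ e, ∏ w ∈ e.erase u, x w) with h | h
    · exact hshift u hu v hv huv hcov h
    · exact hshift v hv u hu huv.symm (fun e he hve hue => hcov e he hue hve) h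

/-! ### Degrees and a subgraph of large minimum degree -/

theorem EdgeCliqueBounded.card_le [DecidableEq V] {k r : ℕ} {E : Finset (Finset V)}
    (hE : EdgeCliqueBounded k E) (hr : ∀ e ∈ E, #e = r) (s : Finset V) :
    (#{e ∈ E | e ⊆ s} : ℝ) ≤ k.choose r * ((#s : ℝ) / k) ^ r := by
  simpa using hE.sum_prod_le hr s (fun _ => 1) fun _ => zero_le_one

theorem card_memberSubfamily [DecidableEq V] (E : Finset (Finset V)) (u : V) :
    #(E.memberSubfamily u) = #{e ∈ E | u ∈ e} := by
  refine card_image_of_injOn fun e he f hf hef => ?_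
  rw [← insert_erase (mem_filter.1 he).2, ← insert_erase (mem_filter.1 hf).2]
  exact congrArg (insert u) hef

/-- A clique of the cover graph of the link of `u` becomes, after adding `u`, a clique of the cover
graph of `E`. The hypothesis `3 ≤ r` makes every vertex of such a clique a neighbour of `u`. -/
theorem EdgeCliqueBounded.memberSubfamily [DecidableEq V] {k r : ℕ} {E : Finset (Finset V)}
    (hE : EdgeCliqueBounded k E) (hr : ∀ e ∈ E, #e = r) (h3 : 3 ≤ r) (u : V) :
    EdgeCliqueBounded (k - 1) (E.memberSubfamily u) := by
  intro f hf Q hfQ hQ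
  obtain ⟨hfE, huf⟩ := mem_memberSubfamily.1 hf
  have hcard : 1 < #Q := by
    have h1 := hr _ hfE
    rw [card_insert_of_notMem huf] at h1
    have := card_le_card hfQ
    omega
  have hadj : ∀ q ∈ Q, (coverGraph E).Adj u q := by
    intro q hq
    obtain ⟨q', hq', hne⟩ := exists_mem_ne hcard q
    obtain ⟨-, g, hg, hqg, -⟩ := hQ hq hq' hne.symm
    obtain ⟨hgE, hug⟩ := mem_memberSubfamily.1 hg
    exact ⟨fun h => hug (h ▸ hqg), _, hgE, mem_insert_self _ _, mem_insert_of_mem hqg⟩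
  have huQ : u ∉ Q := fun h => (coverGraph E).irrefl (hadj u h)
  have hle : ∀ {a b : V}, (coverGraph (E.memberSubfamily u)).Adj a b →
      (coverGraph E).Adj a b := by
    rintro a b ⟨hne, g, hg, ha, hb⟩
    exact ⟨hne, _, (mem_memberSubfamily.1 hg).1, mem_insert_of_mem ha, mem_insert_of_mem hb⟩
  have hclique : (coverGraph E).IsClique (insert u Q : Finset V) := by
    rw [coe_insert, SimpleGraph.isClique_insert]
    exact ⟨fun a ha b hb hab => hle (hQ ha hb hab), fun b hb _ => hadj b hb⟩
  have := hE _ hfE (insert u Q) (insert_subset_insert u hfQ) hclique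
  rw [card_insert_of_notMem huQ] at this
  omega

/-- The number of edges at `u` is bounded by the number of neighbours of `u` in the cover graph:
the bound for the link, with all vertices outside the neighbourhood having weight `0`. -/
theorem EdgeCliqueBounded.card_edges_at_le [DecidableEq V] {k r : ℕ} {E : Finset (Finset V)}
    (hE : EdgeCliqueBounded k E) (hr : ∀ e ∈ E, #e = r) (h3 : 3 ≤ r) (u : V) (N : Finset V)
    (hN : ∀ w, (coverGraph E).Adj u w → w ∈ N) :
    (#{e ∈ E | u ∈ e} : ℝ) ≤ (k - 1).choose (r - 1) * ((#N : ℝ) / (k - 1 : ℕ)) ^ (r - 1) := by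
  have h := (hE.memberSubfamily hr h3 u).card_le (r := r - 1) (fun f hf => by
    obtain ⟨hfE, huf⟩ := mem_memberSubfamily.1 hf
    have h1 := hr _ hfE
    rw [card_insert_of_notMem huf] at h1
    omega) N
  rwa [filter_true_of_mem, card_memberSubfamily] at h
  intro f hf w hw
  obtain ⟨hfE, huf⟩ := mem_memberSubfamily.1 hf
  exact hN w ⟨fun h => huf (h ▸ hw), _, hfE, mem_insert_self _ _, mem_insert_of_mem hw⟩

/-- A nearly extremal family induces, on almost all vertices, a family in which all degrees are
almost as large as possible: `U` maximises the number of edges minus `(1 - γ)` times the maximum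
number of edges on `#U` vertices. -/
theorem EdgeCliqueBounded.exists_large_minDegree [Fintype V] [DecidableEq V] {k r : ℕ}
    {E : Finset (Finset V)} (hE : EdgeCliqueBounded k E) (hr : ∀ e ∈ E, #e = r) (hr0 : r ≠ 0)
    (hrk : r ≤ k) {γ : ℝ} (hγ0 : 0 < γ)
    (hcard : (1 - γ ^ 2) * (k.choose r * ((Fintype.card V : ℝ) / k) ^ r) ≤ #E) :
    ∃ U : Finset V, (1 - γ) * Fintype.card V ≤ #U ∧ ∀ v ∈ U,
      (1 - γ) * ((k.choose r / (k : ℝ) ^ r) * ((#U : ℝ) ^ r - ((#U : ℝ) - 1) ^ r)) ≤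
        #{e ∈ E | e ⊆ U ∧ v ∈ e} := by
  set c : ℝ := k.choose r / (k : ℝ) ^ r with hc
  have hc0 : 0 < c := by
    have h1 : 0 < k.choose r := Nat.choose_pos hrk
    have h2 : 0 < k := by omega
    positivity
  have hceq : ∀ m : ℝ, (k.choose r : ℝ) * (m / k) ^ r = c * m ^ r := fun m => by
    rw [hc, div_pow]; ring
  rw [hceq] at hcard
  obtain ⟨U, -, hU⟩ := exists_max_image (univ : Finset (Finset V))
    (fun U => (#{e ∈ E | e ⊆ U} : ℝ) - (1 - γ) * (c * (#U : ℝ) ^ r)) univ_nonempty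
  have hm : (#U : ℝ) ≤ Fintype.card V := by exact_mod_cast card_le_univ U
  refine ⟨U, ?_, fun v hv => ?_⟩
  · rcases (Nat.cast_nonneg (α := ℝ) (Fintype.card V)).eq_or_lt with h0 | hn
    · rw [← h0, mul_zero]; positivity
    have h1 := hU univ (mem_univ _)
    simp only [subset_univ, filter_true, card_univ] at h1
    have h2 := hE.card_le hr U
    rw [hceq] at h2
    have h3 : γ * c * ((1 - γ) * (Fintype.card V : ℝ) ^ r) ≤ γ * c * (#U : ℝ) ^ r := by nlinarith
    have h4 := le_of_mul_le_mul_left h3 (by positivity)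
    rw [← le_div_iff₀ (by positivity), ← div_pow] at h4
    rw [← le_div_iff₀ hn]
    exact h4.trans (pow_le_of_le_one (by positivity) ((div_le_one hn).2 hm) hr0)
  · have h1 := hU (U.erase v) (mem_univ _)
    have h2 : #{e ∈ E | e ⊆ U} = #{e ∈ E | e ⊆ U ∧ v ∈ e} + #{e ∈ E | e ⊆ U.erase v} := by
      rw [← card_filter_add_card_filter_not (fun e => v ∈ e), filter_filter, filter_filter]
      congr 2
      exact filter_congr fun e _ => by rw [subset_erase]
    have h3 : ((#(U.erase v) : ℕ) : ℝ) = #U - 1 := by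
      rw [card_erase_of_mem hv, Nat.cast_sub (card_pos.2 ⟨v, hv⟩), Nat.cast_one]
    rw [h3, h2] at h1
    push_cast at h1
    linarith

/-- Comparison of the lower bound for degrees on `m` vertices with the upper bound in terms of the
number `D` of neighbours, for `k = j + 1` and `r = q + 1`. -/
theorem le_of_degree_bounds {j q : ℕ} (hq : 2 ≤ q) (hqj : q ≤ j) {γ m D : ℝ} (hγ0 : 0 < γ)
    (hγ : γ ≤ 1 / 2) (hD : 0 ≤ D) (hm : 1 ≤ m) (hqm : q ≤ γ * m)
    (h : (1 - γ) * (((j + 1).choose (q + 1) / ((j + 1 : ℕ) : ℝ) ^ (q + 1)) *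
      (m ^ (q + 1) - (m - 1) ^ (q + 1))) ≤ j.choose q * (D / j) ^ q) :
    (1 - 2 * γ) * (j / (j + 1) * m) ≤ D := by
  have hj : (0 : ℝ) < j := by exact_mod_cast (show 0 < j by omega)
  have hm0 : 0 < m := by linarith
  have hC : (0 : ℝ) < j.choose q := by exact_mod_cast Nat.choose_pos hqj
  have h1 : ((j : ℝ) + 1) * j.choose q = (j + 1).choose (q + 1) * (q + 1) := by
    exact_mod_cast Nat.add_one_mul_choose_eq j q
  have h2 : ((q : ℝ) + 1) * (m - 1) ^ q ≤ m ^ (q + 1) - (m - 1) ^ (q + 1) := by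
    have := pow_add_mul_sub_mul_pow_le (a := m - 1) (y := m) (by linarith) (by linarith) q
    have h' : m - (m - 1) = 1 := by ring
    rw [h', mul_one] at this
    linarith
  have h3 : (1 - γ) * m ^ q ≤ (m - 1) ^ q := by
    obtain ⟨t, rfl⟩ : ∃ t, q = t + 1 := ⟨q - 1, by omega⟩
    have := pow_add_mul_sub_mul_pow_le (a := m) (y := m - 1) (by linarith) (by linarith) t
    have h' := mul_le_mul_of_nonneg_right hqm (pow_nonneg hm0.le t)
    push_cast at h'
    calc (1 - γ) * m ^ (t + 1) = m ^ (t + 1) - γ * m * m ^ t := by ring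
      _ ≤ m ^ (t + 1) + (t + 1) * (m - 1 - m) * m ^ t := by linarith
      _ ≤ _ := this
  have h4 : (1 - 2 * γ) * (m / (j + 1)) ^ q ≤ (D / j) ^ q := by
    refine le_of_mul_le_mul_left ?_ hC
    refine le_trans ?_ h
    have h5 : ((q : ℝ) + 1) * ((1 - γ) * m ^ q) ≤ m ^ (q + 1) - (m - 1) ^ (q + 1) :=
      (mul_le_mul_of_nonneg_left h3 (by positivity)).trans h2
    have h6 : (j.choose q : ℝ) = (j + 1).choose (q + 1) * (q + 1) / (j + 1) := by
      rw [← h1]; field_simp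
    have h7 : (0 : ℝ) ≤ (1 - γ) * ((j + 1).choose (q + 1) / ((j + 1 : ℕ) : ℝ) ^ (q + 1)) :=
      mul_nonneg (by linarith) (by positivity)
    have h8 := mul_le_mul_of_nonneg_left h5 h7
    rw [mul_assoc (1 - γ) _ (m ^ (q + 1) - _)] at h8
    refine le_trans ?_ h8
    rw [h6, div_pow]
    have h9 : (0 : ℝ) ≤ γ ^ 2 * ((j + 1).choose (q + 1) * (q + 1) * m ^ q / (j + 1) ^ (q + 1)) := by
      positivity
    have e1 : (1 - γ) * ((j + 1).choose (q + 1) / ((j + 1 : ℕ) : ℝ) ^ (q + 1)) *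
        ((q + 1) * ((1 - γ) * m ^ q)) = (1 - γ) ^ 2 *
          ((j + 1).choose (q + 1) * (q + 1) * m ^ q / (j + 1) ^ (q + 1)) := by
      push_cast; ring
    have e2 : ((j + 1).choose (q + 1) : ℝ) * (q + 1) / (j + 1) *
        ((1 - 2 * γ) * (m ^ q / (j + 1) ^ q)) = (1 - 2 * γ) *
          ((j + 1).choose (q + 1) * (q + 1) * m ^ q / (j + 1) ^ (q + 1)) := by
      field_simp
      ring
    rw [e1, e2]
    linarith
  by_contra hlt
  push Not at hlt
  have h5 : D / j < (1 - 2 * γ) * (m / (j + 1)) := by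
    rw [div_lt_iff₀ hj]
    calc D < _ := hlt
      _ = _ := by ring
  have h6 := pow_lt_pow_left₀ h5 (by positivity) (show q ≠ 0 by omega)
  rw [mul_pow] at h6
  have h7 : (1 - 2 * γ) ^ q ≤ 1 - 2 * γ :=
    pow_le_of_le_one (by linarith) (by linarith) (by omega)
  have h8 := mul_le_mul_of_nonneg_right h7 (show 0 ≤ (m / (j + 1)) ^ q by positivity)
  linarith

/-! ### The partite structure forced by large minimum degree -/

instance [DecidableEq V] (E : Finset (Finset V)) : DecidableRel (coverGraph E).Adj :=
  fun u v => inferInstanceAs (Decidable (u ≠ v ∧ ∃ e ∈ E, u ∈ e ∧ v ∈ e))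

/-- The vertices of `U` that are not covered together with `v`. This contains `v` itself, if
`v ∈ U`. -/
def nonNeighbors [DecidableEq V] (E : Finset (Finset V)) (U : Finset V) (v : V) : Finset V :=
  {w ∈ U | ¬ (coverGraph E).Adj v w}

theorem card_le_sum_of_subset_biUnion [DecidableEq V] {U Q : Finset V} {I : V → Finset V}
    (h : U ⊆ Q.biUnion I) : (#U : ℝ) ≤ ∑ q ∈ Q, (#(I q) : ℝ) := by
  exact_mod_cast (card_le_card h).trans card_biUnion_le

section Structure

variable [DecidableEq V] {k r : ℕ} {E : Finset (Finset V)} {U : Finset V} {x y : ℝ}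

/-- Every edge extends to a clique with `k` vertices, whose sets of non-neighbours cover `U`. Here
and below `y` stands for `#U / k` and `x` for the small excess allowed in the number of
non-neighbours. -/
theorem EdgeCliqueBounded.exists_clique (hE : EdgeCliqueBounded k E) (hU : ∀ e ∈ E, e ⊆ U)
    (hI : ∀ v ∈ U, (#(nonNeighbors E U v) : ℝ) ≤ y + x) (hy : k * y = #U) (hx : 0 ≤ x)
    (hxy : k * x < y) {e : Finset V} (he : e ∈ E) :
    ∃ T : Finset V, e ⊆ T ∧ T ⊆ U ∧ #T = k ∧ (coverGraph E).IsClique (T : Set V) ∧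
      U ⊆ T.biUnion (nonNeighbors E U) := by
  have hinsert : ∀ (Q : Finset V) (w : V), (coverGraph E).IsClique (Q : Set V) → w ∈ U →
      w ∉ Q.biUnion (nonNeighbors E U) →
      w ∉ Q ∧ (coverGraph E).IsClique ((insert w Q : Finset V) : Set V) := by
    intro Q w hQ hw hwQ
    have hadj : ∀ q ∈ Q, (coverGraph E).Adj w q := by
      intro q hq
      by_contra h
      exact hwQ (mem_biUnion.2 ⟨q, hq, mem_filter.2 ⟨hw, fun h' => h h'.symm⟩⟩)
    refine ⟨fun h => (coverGraph E).irrefl (hadj w h), ?_⟩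
    rw [coe_insert, SimpleGraph.isClique_insert]
    exact ⟨hQ, fun b hb _ => hadj b hb⟩
  have hece : (coverGraph E).IsClique (e : Set V) := fun a ha b hb hab => ⟨hab, e, he, ha, hb⟩
  obtain ⟨T, hT, hmax⟩ := exists_max_image
    {T ∈ U.powerset | e ⊆ T ∧ (coverGraph E).IsClique (T : Set V)} card
    ⟨e, mem_filter.2 ⟨mem_powerset.2 (hU e he), Subset.rfl, hece⟩⟩
  obtain ⟨hTU, heT, hTc⟩ := mem_filter.1 hT
  rw [mem_powerset] at hTU
  have hcover : U ⊆ T.biUnion (nonNeighbors E U) := by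
    intro w hw
    by_contra hwT
    obtain ⟨hwT', hc⟩ := hinsert T w hTc hw hwT
    have := hmax (insert w T) (mem_filter.2
      ⟨mem_powerset.2 (insert_subset hw hTU), heT.trans (subset_insert _ _), hc⟩)
    rw [card_insert_of_notMem hwT'] at this
    omega
  refine ⟨T, heT, hTU, le_antisymm (hE e he T heT hTc) ?_, hTc, hcover⟩
  by_contra hlt
  push Not at hlt
  have h1 := card_le_sum_of_subset_biUnion hcover
  have h2 : ∑ q ∈ T, (#(nonNeighbors E U q) : ℝ) ≤ #T * (y + x) := by
    rw [← nsmul_eq_mul]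
    exact sum_le_card_nsmul _ _ _ fun q hq => hI q (hTU hq)
  have h3 : (#T : ℝ) + 1 ≤ k := by exact_mod_cast hlt
  have hy0 : 0 < y := lt_of_le_of_lt (by positivity) hxy
  have h4 : (#T : ℝ) * (y + x) ≤ (k - 1) * (y + x) :=
    mul_le_mul_of_nonneg_right (by linarith) (by linarith)
  nlinarith

/-- A vertex `v` of an edge has nearly `#U / k` non-neighbours: it lies in a `k`-clique whose sets
of non-neighbours cover `U`, and the other `k - 1` of these are not much larger than `#U / k`. -/
theorem EdgeCliqueBounded.card_nonNeighbors_ge (hE : EdgeCliqueBounded k E)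
    (hU : ∀ e ∈ E, e ⊆ U) (hI : ∀ v ∈ U, (#(nonNeighbors E U v) : ℝ) ≤ y + x)
    (hy : k * y = #U) (hx : 0 ≤ x) (hxy : k * x < y) {e : Finset V} (he : e ∈ E) {v : V}
    (hv : v ∈ e) : y - (k - 1) * x ≤ #(nonNeighbors E U v) := by
  obtain ⟨T, heT, hTU, hTk, -, hcover⟩ := hE.exists_clique hU hI hy hx hxy he
  have h1 := card_le_sum_of_subset_biUnion hcover
  rw [← add_sum_erase T _ (heT hv)] at h1
  have h2 : ∑ q ∈ T.erase v, (#(nonNeighbors E U q) : ℝ) ≤ #(T.erase v) * (y + x) := by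
    rw [← nsmul_eq_mul]
    exact sum_le_card_nsmul _ _ _ fun q hq => hI q (hTU (mem_of_mem_erase hq))
  rw [card_erase_of_mem (heT hv), Nat.cast_sub (card_pos.2 ⟨v, heT hv⟩), hTk] at h2
  push_cast at h2
  nlinarith

/-- Two vertices that are covered together have few common non-neighbours: the `k` sets of
non-neighbours of the vertices of a `k`-clique cover `U` with almost no room for overlap. -/
theorem EdgeCliqueBounded.card_inter_nonNeighbors_le (hE : EdgeCliqueBounded k E)
    (hU : ∀ e ∈ E, e ⊆ U) (hI : ∀ v ∈ U, (#(nonNeighbors E U v) : ℝ) ≤ y + x)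
    (hy : k * y = #U) (hx : 0 ≤ x) (hxy : k * x < y) {u v : V} (huv : (coverGraph E).Adj u v) :
    (#(nonNeighbors E U u ∩ nonNeighbors E U v) : ℝ) ≤ k * x := by
  obtain ⟨hne, e, he, hu, hv⟩ := huv
  obtain ⟨T, heT, hTU, hTk, -, hcover⟩ := hE.exists_clique hU hI hy hx hxy he
  have hvT : v ∈ T.erase u := mem_erase.2 ⟨hne.symm, heT hv⟩
  have h0 : U ⊆ (nonNeighbors E U u ∪ nonNeighbors E U v) ∪
      ((T.erase u).erase v).biUnion (nonNeighbors E U) := by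
    refine hcover.trans fun w hw => ?_
    obtain ⟨t, ht, hwt⟩ := mem_biUnion.1 hw
    rw [mem_union, mem_union, mem_biUnion]
    by_cases h1 : t = u
    · exact Or.inl (Or.inl (h1 ▸ hwt))
    by_cases h2 : t = v
    · exact Or.inl (Or.inr (h2 ▸ hwt))
    exact Or.inr ⟨t, mem_erase.2 ⟨h2, mem_erase.2 ⟨h1, ht⟩⟩, hwt⟩
  have h1 : (#U : ℝ) ≤ #(nonNeighbors E U u ∪ nonNeighbors E U v) +
      ∑ q ∈ (T.erase u).erase v, (#(nonNeighbors E U q) : ℝ) := by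
    exact_mod_cast (card_le_card h0).trans ((card_union_le _ _).trans
      (Nat.add_le_add_left card_biUnion_le _))
  have h2 : ∑ q ∈ (T.erase u).erase v, (#(nonNeighbors E U q) : ℝ) ≤
      #((T.erase u).erase v) * (y + x) := by
    rw [← nsmul_eq_mul]
    exact sum_le_card_nsmul _ _ _ fun q hq =>
      hI q (hTU (mem_of_mem_erase (mem_of_mem_erase hq)))
  have h3 : #((T.erase u).erase v) + 2 = k := by
    have e1 := card_erase_add_one hvT
    have e2 := card_erase_add_one (heT hu)
    omega
  have h4 : (#((T.erase u).erase v) : ℝ) = k - 2 := by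
    rw [← h3]; push_cast; ring
  have h5 : (#(nonNeighbors E U u ∪ nonNeighbors E U v) : ℝ) +
      #(nonNeighbors E U u ∩ nonNeighbors E U v) =
      #(nonNeighbors E U u) + #(nonNeighbors E U v) := by
    exact_mod_cast card_union_add_card_inter _ _
  have h6 := hI u (hTU (heT hu))
  have h7 := hI v (hTU (heT hv))
  rw [h4] at h2
  nlinarith

/-- If every vertex has only slightly more than a `1 / k` fraction of non-neighbours, then up to
few exceptional vertices the family is `k`-partite, with parts that are not too large. The parts
are the sets of non-neighbours of the vertices of a `k`-clique, and two covered vertices in the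
same part would share almost all of that part as non-neighbours. -/
theorem EdgeCliqueBounded.exists_coloring (hE : EdgeCliqueBounded k E) (hk : 2 ≤ k)
    (hU : ∀ e ∈ E, e ⊆ U) (hne : E.Nonempty)
    (hI : ∀ v ∈ U, (#(nonNeighbors E U v) : ℝ) ≤ y + x) (hy : k * y = #U) (hx : 0 ≤ x)
    (hy0 : 0 < y) (hxy : 8 * k ^ 2 * x ≤ y) :
    ∃ (c : V → Fin k) (B : Finset V), (#B : ℝ) ≤ k ^ 3 * x ∧
      (∀ i, (#{v ∈ U | c v = i} : ℝ) ≤ y + x) ∧ ∀ e ∈ E, Disjoint e B → Set.InjOn c e := by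
  have hk2 : (2 : ℝ) ≤ k := by exact_mod_cast hk
  have hkx : k * x ≤ k ^ 2 * x := mul_le_mul_of_nonneg_right (by nlinarith) hx
  have hxk : x ≤ k * x := le_mul_of_one_le_left hx (by linarith)
  have hxy' : k * x < y := by
    rcases hx.eq_or_lt with h | h
    · rw [← h, mul_zero]; exact hy0
    · have : 0 < (k : ℝ) ^ 2 * x := by positivity
      linarith
  have hinter := fun {u v : V} => hE.card_inter_nonNeighbors_le hU hI hy hx hxy' (u := u) (v := v)
  obtain ⟨e₀, he₀⟩ := hne
  obtain ⟨T, -, hTU, hTk, hTc, hcover⟩ := hE.exists_clique hU hI hy hx hxy' he₀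
  let vtx : Fin k ≃ T := (T.equivFinOfCardEq hTk).symm
  have : NeZero k := ⟨by omega⟩
  have hc : ∀ v, ∃ i : Fin k, v ∈ U → v ∈ nonNeighbors E U (vtx i) := by
    intro v
    by_cases hv : v ∈ U
    · obtain ⟨t, ht, hvt⟩ := mem_biUnion.1 (hcover hv)
      exact ⟨vtx.symm ⟨t, ht⟩, fun _ => by simpa using hvt⟩
    · exact ⟨0, fun h => absurd h hv⟩
  choose c hc using hc
  have hvtx : ∀ i, (vtx i : V) ∈ U := fun i => hTU (vtx i).2
  have hTadj : ∀ i j, i ≠ j →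
      (#(nonNeighbors E U (vtx i) ∩ nonNeighbors E U (vtx j)) : ℝ) ≤ k * x :=
    fun i j hij => hinter (hTc (vtx i).2 (vtx j).2 fun h => hij (vtx.injective (Subtype.ext h)))
  refine ⟨c, {v ∈ U | ∃ j, j ≠ c v ∧ v ∈ nonNeighbors E U (vtx j)}, ?_, fun i => ?_, ?_⟩
  · -- The exceptional vertices are those having two non-neighbours in the clique.
    have h1 : {v ∈ U | ∃ j, j ≠ c v ∧ v ∈ nonNeighbors E U (vtx j)} ⊆
        (univ : Finset (Fin k × Fin k)).biUnion (fun p =>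
          if p.1 = p.2 then ∅ else nonNeighbors E U (vtx p.1) ∩ nonNeighbors E U (vtx p.2)) := by
      intro v hv
      obtain ⟨hvU, j, hj, hvj⟩ := mem_filter.1 hv
      refine mem_biUnion.2 ⟨(j, c v), mem_univ _, ?_⟩
      rw [if_neg hj]
      exact mem_inter.2 ⟨hvj, hc v hvU⟩
    have h2 := card_le_card h1 |>.trans card_biUnion_le
    calc _ ≤ ∑ p : Fin k × Fin k, (#(if p.1 = p.2 then ∅ else
          nonNeighbors E U (vtx p.1) ∩ nonNeighbors E U (vtx p.2)) : ℝ) := by exact_mod_cast h2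
      _ ≤ #(univ : Finset (Fin k × Fin k)) • (k * x) := by
          refine sum_le_card_nsmul _ _ _ fun p _ => ?_
          split_ifs with h
          · simpa using by positivity
          · exact hTadj _ _ h
      _ = k ^ 3 * x := by
          rw [nsmul_eq_mul, card_univ, Fintype.card_prod, Fintype.card_fin]
          push_cast; ring
  · refine le_trans ?_ (hI _ (hvtx i))
    refine Nat.cast_le.2 (card_le_card fun v hv => ?_)
    obtain ⟨hvU, rfl⟩ := mem_filter.1 hv
    exact hc v hvU
  · intro e he hB w hw w' hw' hcc
    by_contra hww
    -- A vertex `z` of `e` is adjacent to all vertices of the clique but `vtx (c z)`, so its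
    -- non-neighbours are mostly among those of `vtx (c z)`.
    have hkey : ∀ z ∈ e, y - (k ^ 2 - 1) * x ≤
        #(nonNeighbors E U z ∩ nonNeighbors E U (vtx (c z))) := by
      intro z hz
      have hzU := hU e he hz
      have h1 := hE.card_nonNeighbors_ge hU hI hy hx hxy' he hz
      have h2 : nonNeighbors E U z ⊆ (nonNeighbors E U z ∩ nonNeighbors E U (vtx (c z))) ∪
          (univ.erase (c z)).biUnion
            (fun j => nonNeighbors E U z ∩ nonNeighbors E U (vtx j)) := by
        intro a ha
        have haU : a ∈ U := (mem_filter.1 ha).1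
        by_cases h : c a = c z
        · exact mem_union_left _ (mem_inter.2 ⟨ha, h ▸ hc a haU⟩)
        · exact mem_union_right _ (mem_biUnion.2
            ⟨c a, mem_erase.2 ⟨h, mem_univ _⟩, mem_inter.2 ⟨ha, hc a haU⟩⟩)
      have h3 : (#(nonNeighbors E U z) : ℝ) ≤
          #(nonNeighbors E U z ∩ nonNeighbors E U (vtx (c z))) +
          ∑ j ∈ univ.erase (c z), (#(nonNeighbors E U z ∩ nonNeighbors E U (vtx j)) : ℝ) := by
        exact_mod_cast (card_le_card h2).trans ((card_union_le _ _).trans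
          (Nat.add_le_add_left card_biUnion_le _))
      have h4 : ∑ j ∈ univ.erase (c z), (#(nonNeighbors E U z ∩ nonNeighbors E U (vtx j)) : ℝ) ≤
          #(univ.erase (c z)) * (k * x) := by
        rw [← nsmul_eq_mul]
        refine sum_le_card_nsmul _ _ _ fun j hj => hinter ?_
        by_contra hadj
        refine disjoint_left.1 hB hz (mem_filter.2 ⟨hzU, j, (mem_erase.1 hj).1, ?_⟩)
        exact mem_filter.2 ⟨hzU, fun h => hadj h.symm⟩
      rw [card_erase_of_mem (mem_univ _), card_univ, Fintype.card_fin,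
        Nat.cast_sub (by omega), Nat.cast_one] at h4
      linarith
    have h1 := hkey w hw
    have h2 := hkey w' hw'
    rw [← hcc] at h2
    have h3 := hinter (u := w) (v := w') ⟨hww, e, he, hw, hw'⟩
    have h4 := hI _ (hvtx (c w))
    have h5 : #(nonNeighbors E U w ∩ nonNeighbors E U (vtx (c w))) +
        #(nonNeighbors E U w' ∩ nonNeighbors E U (vtx (c w))) ≤
        #(nonNeighbors E U (vtx (c w))) + #(nonNeighbors E U w ∩ nonNeighbors E U w') := by
      rw [← card_union_add_card_inter]
      refine Nat.add_le_add (card_le_card ?_) (card_le_card ?_)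
      · exact union_subset inter_subset_right inter_subset_right
      · exact fun a ha => mem_inter.2 ⟨(mem_inter.1 (mem_inter.1 ha).1).1,
          (mem_inter.1 (mem_inter.1 ha).2).1⟩
    have h6 : (#(nonNeighbors E U w ∩ nonNeighbors E U (vtx (c w))) : ℝ) +
        #(nonNeighbors E U w' ∩ nonNeighbors E U (vtx (c w))) ≤
        #(nonNeighbors E U (vtx (c w))) + #(nonNeighbors E U w ∩ nonNeighbors E U w') := by
      exact_mod_cast h5
    nlinarith

end Structure

/-! ### Balanced colourings and edge stability -/

/-- A colouring whose colour classes are not much larger than average agrees with a balanced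
colouring outside few vertices. The `ρ`-th vertex of colour `i` is sent to the integer `i + k * ρ`;
where this is less than `n` it is kept, and the resulting partial injection is extended to a
bijection onto `{0, …, n - 1}`, whose residues modulo `k` are balanced. -/
theorem exists_balanced_coloring_near {n k : ℕ} (c₀ : Fin n → Fin k) {s : ℝ} (hs : 0 ≤ s)
    (hk : 0 < k) (h : ∀ i, (#{v | c₀ v = i} : ℝ) ≤ n / k + s) :
    ∃ c : Fin n → Fin k, (∀ i j : Fin k, Nat.card {v // c v = i} ≤ Nat.card {v // c v = j} + 1) ∧
      (#{v | c v ≠ c₀ v} : ℝ) ≤ k * (s + 1) := by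
  classical
  let rank : Fin n → ℕ := fun v => #{w | w < v ∧ c₀ w = c₀ v}
  have hrank : ∀ v v', v < v' → c₀ v = c₀ v' → rank v < rank v' := by
    intro v v' hlt hc
    refine card_lt_card ⟨fun w hw => ?_, fun hsub => ?_⟩
    · rw [mem_filter] at hw ⊢
      exact ⟨hw.1, hw.2.1.trans hlt, hw.2.2.trans hc⟩
    · have : v ∈ ({w | w < v ∧ c₀ w = c₀ v} : Finset (Fin n)) :=
        hsub (mem_filter.2 ⟨mem_univ _, hlt, hc⟩)
      exact lt_irrefl v (mem_filter.1 this).2.1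
  have hinj : ∀ v v', c₀ v = c₀ v' → rank v = rank v' → v = v' := by
    intro v v' hc hr
    rcases lt_trichotomy v v' with hlt | heq | hlt
    · exact absurd hr (hrank v v' hlt hc).ne
    · exact heq
    · exact absurd hr (hrank v' v hlt hc.symm).ne'
  let f : Fin n → ℕ := fun v => c₀ v + k * rank v
  have hfmod : ∀ v, f v % k = c₀ v := fun v => by
    simp only [f, Nat.add_mul_mod_self_left]
    exact Nat.mod_eq_of_lt (c₀ v).2
  have hfinj : Function.Injective f := by
    intro v v' hv
    have hc : c₀ v = c₀ v' := Fin.ext (by rw [← hfmod v, ← hfmod v', hv])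
    refine hinj v v' hc (Nat.eq_of_mul_eq_mul_left hk ?_)
    have : (c₀ v : ℕ) + k * rank v = c₀ v' + k * rank v' := hv
    rw [hc] at this
    omega
  obtain ⟨g, hg⟩ := Finset.exists_equiv_extend_of_card_eq (α := Fin n) (t := range n) (by simp)
    (s := ({v | f v < n} : Finset (Fin n))) (f := f)
    (fun a ha => by
      obtain ⟨v, hv, rfl⟩ := mem_image.1 ha
      exact mem_range.2 (mem_filter.1 hv).2) hfinj.injOn
  refine ⟨fun v => ⟨(g v : ℕ) % k, Nat.mod_lt _ hk⟩, ?_, ?_⟩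
  · have hcount : ∀ i : Fin k, Nat.card {v // (⟨(g v : ℕ) % k, Nat.mod_lt _ hk⟩ : Fin k) = i} =
        n.count (· ≡ i [MOD k]) := by
      intro i
      rw [Nat.count_eq_card_filter_range, Nat.card_eq_fintype_card, Fintype.card_subtype]
      refine card_bij (fun v _ => (g v : ℕ)) (fun v hv => ?_)
        (fun v _ w _ hvw => g.injective (Subtype.ext hvw)) (fun a ha => ?_)
      · refine mem_filter.2 ⟨(g v).2, ?_⟩
        have h1 : (g v : ℕ) % k = i := congrArg Fin.val (mem_filter.1 hv).2
        rw [Nat.ModEq, h1, Nat.mod_eq_of_lt i.2]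
      · obtain ⟨ha, hai⟩ := mem_filter.1 ha
        refine ⟨g.symm ⟨a, ha⟩, mem_filter.2 ⟨mem_univ _, Fin.ext ?_⟩, by simp⟩
        rw [Nat.ModEq, Nat.mod_eq_of_lt i.2] at hai
        simpa using hai
    intro i j
    rw [hcount, hcount, Nat.count_modEq_card _ hk, Nat.count_modEq_card _ hk]
    split_ifs <;> omega
  · have hsub : ({v | (⟨(g v : ℕ) % k, Nat.mod_lt _ hk⟩ : Fin k) ≠ c₀ v} : Finset (Fin n)) ⊆
        (univ : Finset (Fin k)).biUnion fun i => {v | c₀ v = i ∧ n ≤ f v} := by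
      intro v hv
      refine mem_biUnion.2 ⟨c₀ v, mem_univ _, mem_filter.2 ⟨mem_univ _, rfl, ?_⟩⟩
      by_contra hlt
      refine (mem_filter.1 hv).2 (Fin.ext ?_)
      have := hg v (mem_filter.2 ⟨mem_univ _, not_le.1 hlt⟩)
      simp only [this, hfmod]
    have hclass : ∀ i : Fin k, (#{v | c₀ v = i ∧ n ≤ f v} : ℝ) ≤ s + 1 := by
      intro i
      have h1 : #{v | c₀ v = i ∧ n ≤ f v} ≤ #(Ico (n / k) (#{v | c₀ v = i})) := by
        refine card_le_card_of_injOn rank ?_ ?_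
        · intro v hv
          obtain ⟨-, rfl, hvn⟩ := mem_filter.1 (mem_coe.1 hv)
          rw [mem_coe, mem_Ico]
          constructor
          · have h1 : (c₀ v : ℕ) < k := (c₀ v).2
            have h2 : n ≤ c₀ v + k * rank v := hvn
            refine Nat.le_of_lt_succ ((Nat.div_lt_iff_lt_mul hk).2 ?_)
            rw [Nat.succ_mul, mul_comm (rank v)]
            omega
          · refine card_lt_card ⟨fun w hw => ?_, fun hsub => ?_⟩
            · exact mem_filter.2 ⟨mem_univ _, (mem_filter.1 hw).2.2⟩
            · have := hsub (mem_filter.2 ⟨mem_univ v, rfl⟩)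
              exact lt_irrefl v (mem_filter.1 this).2.1
        · intro v hv v' hv' hr
          refine hinj v v' ?_ hr
          rw [(mem_filter.1 (mem_coe.1 hv)).2.1, (mem_filter.1 (mem_coe.1 hv')).2.1]
      rw [Nat.card_Ico] at h1
      have h2 : (n : ℝ) / k < (n / k : ℕ) + 1 := by
        rw [div_lt_iff₀ (by exact_mod_cast hk)]
        exact_mod_cast Nat.lt_mul_of_div_lt (Nat.lt_succ_self _) hk
      have h3 := h i
      rcases le_total (n / k) (#{v | c₀ v = i}) with hle | hle
      · have h4 : (#{v | c₀ v = i ∧ n ≤ f v} : ℝ) ≤ #{v | c₀ v = i} - (n / k : ℕ) := by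
          rw [← Nat.cast_sub hle]; exact_mod_cast h1
        linarith
      · have h4 : #{v | c₀ v = i ∧ n ≤ f v} = 0 := by omega
        rw [h4, Nat.cast_zero]
        linarith
    calc _ ≤ ∑ i : Fin k, (#{v | c₀ v = i ∧ n ≤ f v} : ℝ) := by
          exact_mod_cast (card_le_card hsub).trans card_biUnion_le
      _ ≤ #(univ : Finset (Fin k)) • (s + 1) := sum_le_card_nsmul _ _ _ fun i _ => hclass i
      _ = _ := by rw [card_univ, Fintype.card_fin, nsmul_eq_mul]

/-- Each edge containing `S` is determined by its `r - #S` remaining vertices. -/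
theorem card_filter_subset_le [Fintype V] [DecidableEq V] {r : ℕ} {E : Finset (Finset V)}
    (hr : ∀ e ∈ E, #e = r) (S : Finset V) :
    #{e ∈ E | S ⊆ e} ≤ Fintype.card V ^ (r - #S) := by
  calc _ ≤ #((univ : Finset V).powersetCard (r - #S)) := by
        refine card_le_card_of_injOn (· \ S) ?_ ?_
        · intro e he
          obtain ⟨he, hS⟩ := mem_filter.1 (mem_coe.1 he)
          exact mem_powersetCard.2 ⟨subset_univ _, by rw [card_sdiff_of_subset hS, hr e he]⟩
        · intro e he f hf hef
          rw [← sdiff_union_of_subset (mem_filter.1 (mem_coe.1 he)).2,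
            ← sdiff_union_of_subset (mem_filter.1 (mem_coe.1 hf)).2]
          exact congrArg (· ∪ S) hef
    _ ≤ _ := by
        rw [card_powersetCard, card_univ]
        exact Nat.choose_le_pow _ _

theorem card_filter_not_disjoint_le [Fintype V] [DecidableEq V] {r : ℕ} {E : Finset (Finset V)}
    (hr : ∀ e ∈ E, #e = r) (W : Finset V) :
    #{e ∈ E | ¬ Disjoint e W} ≤ #W * Fintype.card V ^ (r - 1) := by
  have h1 : {e ∈ E | ¬ Disjoint e W} ⊆ W.biUnion fun w => {e ∈ E | {w} ⊆ e} := by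
    intro e he
    obtain ⟨heE, hW⟩ := mem_filter.1 he
    obtain ⟨w, hwe, hwW⟩ := not_disjoint_iff.1 hW
    exact mem_biUnion.2 ⟨w, hwW, mem_filter.2 ⟨heE, singleton_subset_iff.2 hwe⟩⟩
  exact (card_le_card h1).trans
    (card_biUnion_le_card_mul _ _ _ fun w _ => by simpa using card_filter_subset_le hr {w})

/-- **Edge stability.** A nearly extremal family is `k`-partite with respect to a balanced
partition, apart from the edges meeting a small set of vertices. -/
theorem EdgeCliqueBounded.exists_balanced_coloring {k r n : ℕ} {E : Finset (Finset (Fin n))}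
    (hE : EdgeCliqueBounded k E) (hr : ∀ e ∈ E, #e = r) (h3 : 3 ≤ r) (hrk : r ≤ k) {γ : ℝ}
    (hγ0 : 0 < γ) (hγ : 16 * k ^ 3 * γ ≤ 1) (hn : 2 * r ≤ γ * n)
    (hcard : (1 - γ ^ 2) * (k.choose r * ((n : ℝ) / k) ^ r) ≤ #E) :
    ∃ c : Fin n → Fin k,
      (∀ i j : Fin k, Nat.card {v // c v = i} ≤ Nat.card {v // c v = j} + 1) ∧
      ∃ W : Finset (Fin n), (#W : ℝ) ≤ 7 * k ^ 3 * γ * n ∧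
        ∀ e ∈ E, Disjoint e W → Set.InjOn c e := by
  have hk3 : (3 : ℝ) ≤ k := by exact_mod_cast h3.trans hrk
  have hr3 : (3 : ℝ) ≤ r := by exact_mod_cast h3
  have hkk : (k : ℝ) ≤ k ^ 3 := by nlinarith [mul_nonneg (sub_nonneg.2 hk3) (sub_nonneg.2 hk3)]
  have hγ2 : γ ≤ 1 / 2 := by nlinarith
  obtain ⟨U, hUcard, hUdeg⟩ := hE.exists_large_minDegree hr (by omega) hrk hγ0
    (by rwa [Fintype.card_fin])
  rw [Fintype.card_fin] at hUcard
  have hn0 : (0 : ℝ) ≤ n := Nat.cast_nonneg n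
  have hUn : (#U : ℝ) ≤ n := by
    have := card_le_univ U
    rw [Fintype.card_fin] at this
    exact_mod_cast this
  have hrm : (r : ℝ) ≤ γ * #U := by nlinarith
  have hm : (1 : ℝ) ≤ #U := by nlinarith
  set F := {e ∈ E | e ⊆ U} with hF
  have hFE : EdgeCliqueBounded k F := hE.mono (filter_subset _ _)
  have hFr : ∀ e ∈ F, #e = r := fun e he => hr e (mem_filter.1 he).1
  have hFU : ∀ e ∈ F, e ⊆ U := fun e he => (mem_filter.1 he).2
  have hFdeg : ∀ v ∈ U, (1 - γ) * ((k.choose r / (k : ℝ) ^ r) *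
      ((#U : ℝ) ^ r - ((#U : ℝ) - 1) ^ r)) ≤ #{e ∈ F | v ∈ e} := by
    intro v hv
    rw [hF, filter_filter]
    exact hUdeg v hv
  have hFne : F.Nonempty := by
    obtain ⟨v, hv⟩ : U.Nonempty := card_pos.1 (by exact_mod_cast (zero_lt_one.trans_le hm))
    have h1 : (0 : ℝ) < #{e ∈ F | v ∈ e} := by
      refine lt_of_lt_of_le ?_ (hFdeg v hv)
      have h2 : ((#U : ℝ) - 1) ^ r < (#U : ℝ) ^ r :=
        pow_lt_pow_left₀ (by linarith) (by linarith) (by omega)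
      have h3 : 0 < k.choose r := Nat.choose_pos hrk
      exact mul_pos (by linarith) (mul_pos (by positivity) (by linarith))
    exact (card_pos.1 (by exact_mod_cast h1)).mono (filter_subset _ _)
  obtain ⟨j, rfl⟩ : ∃ j, k = j + 1 := ⟨k - 1, by omega⟩
  obtain ⟨q, rfl⟩ : ∃ q, r = q + 1 := ⟨r - 1, by omega⟩
  have hI : ∀ v ∈ U, (#(nonNeighbors F U v) : ℝ) ≤ #U / (j + 1 : ℕ) + 2 * γ * #U := by
    intro v hv
    have h1 := hFE.card_edges_at_le hFr h3 v {w ∈ U | (coverGraph F).Adj v w} (fun w hw => by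
      obtain ⟨-, e, he, -, hwe⟩ := id hw
      exact mem_filter.2 ⟨hFU e he hwe, hw⟩)
    have h2 := le_of_degree_bounds (by omega) (by omega) hγ0 hγ2 (Nat.cast_nonneg _) hm
      (by push_cast at hrm; linarith) ((hFdeg v hv).trans h1)
    have h3 : (#{w ∈ U | (coverGraph F).Adj v w} : ℝ) + #(nonNeighbors F U v) = #U := by
      exact_mod_cast card_filter_add_card_filter_not _
    have h4 : (j : ℝ) / (j + 1) * #U = #U - #U / (j + 1 : ℕ) := by
      push_cast; field_simp; ring
    rw [h4] at h2
    have h5 : (0 : ℝ) ≤ #U / (j + 1 : ℕ) := by positivity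
    nlinarith
  set k := j + 1
  have hk0 : (0 : ℝ) < k := by linarith
  obtain ⟨c₀, B, hB, hfib, hinj⟩ := hFE.exists_coloring (by omega) hFU hFne hI
    (by field_simp) (by positivity) (by positivity) (by
      rw [le_div_iff₀ hk0]
      nlinarith)
  have hUc : (#Uᶜ : ℝ) ≤ γ * n := by
    rw [card_compl, Nat.cast_sub (card_le_univ U), Fintype.card_fin]
    linarith
  have hγU : γ * #U ≤ γ * n := mul_le_mul_of_nonneg_left hUn hγ0.le
  obtain ⟨c, hcbal, hcc⟩ := exists_balanced_coloring_near c₀ (s := 3 * (γ * n)) (by positivity)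
    (by omega) (fun i => by
      have h1 : ({v | c₀ v = i} : Finset (Fin n)) ⊆ {v ∈ U | c₀ v = i} ∪ Uᶜ := fun v hv => by
        by_cases hvU : v ∈ U
        · exact mem_union_left _ (mem_filter.2 ⟨hvU, (mem_filter.1 hv).2⟩)
        · exact mem_union_right _ (mem_compl.2 hvU)
      have h2 : (#{v | c₀ v = i} : ℝ) ≤ #{v ∈ U | c₀ v = i} + #Uᶜ := by
        exact_mod_cast (card_le_card h1).trans (card_union_le _ _)
      have h4 := hfib i
      have h5 : (#U : ℝ) / k ≤ n / k := div_le_div_of_nonneg_right hUn hk0.le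
      linarith)
  -- Excluded are the vertices outside `U`, the exceptional ones, and the recoloured ones.
  refine ⟨c, hcbal, Uᶜ ∪ B ∪ ({v | c v ≠ c₀ v} : Finset (Fin n)), ?_, fun e he hdisj => ?_⟩
  · have h1 : (#(Uᶜ ∪ B ∪ ({v | c v ≠ c₀ v} : Finset (Fin n))) : ℝ) ≤
        #Uᶜ + #B + #{v | c v ≠ c₀ v} := by
      exact_mod_cast (card_union_le _ _).trans (Nat.add_le_add_right (card_union_le _ _) _)
    have h4 : (k : ℝ) ^ 3 * (2 * γ * #U) ≤ 2 * (k ^ 3 * (γ * n)) := by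
      have := mul_le_mul_of_nonneg_left hγU (show (0 : ℝ) ≤ 2 * k ^ 3 by positivity)
      linarith
    have h5 : 1 ≤ γ * n := by linarith
    have h6 : (9 : ℝ) * k ≤ k ^ 3 := by
      calc (9 : ℝ) * k ≤ k ^ 2 * k := mul_le_mul_of_nonneg_right (by nlinarith only [hk3]) hk0.le
        _ = k ^ 3 := by ring
    have h7 := mul_le_mul_of_nonneg_right h6 (zero_le_one.trans h5)
    have h8 := mul_le_mul_of_nonneg_left h5 hk0.le
    have h9 := mul_le_mul_of_nonneg_right hk3 (zero_le_one.trans h5)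
    have h10 : (0 : ℝ) ≤ k ^ 3 * (γ * n) := by positivity
    calc _ ≤ _ := h1
      _ ≤ γ * n + 2 * (k ^ 3 * (γ * n)) + k * (3 * (γ * n) + 1) := by linarith
      _ ≤ 7 * (k ^ 3 * (γ * n)) := by linarith
      _ = _ := by ring
  · rw [disjoint_union_right, disjoint_union_right] at hdisj
    obtain ⟨⟨hdU, hdB⟩, hdc⟩ := hdisj
    have heU : e ⊆ U := fun v hv => by
      by_contra hvU
      exact disjoint_left.1 hdU hv (mem_compl.2 hvU)
    have heq : Set.EqOn c₀ c e := fun v hv => by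
      by_contra hne
      exact disjoint_left.1 hdc hv (mem_filter.2 ⟨mem_univ _, fun h => hne h.symm⟩)
    exact (hinj e (mem_filter.2 ⟨he, heU⟩) hdB).congr heq

/-! ### Embedding the generalized fan -/

/-- `P` lies in members of `E` avoiding any prescribed set of at most `M` vertices outside `P`. -/
def RobustlyCovered (M : ℕ) (E : Finset (Finset V)) (P : Finset V) : Prop :=
  ∀ B : Finset V, #B ≤ M → Disjoint P B → ∃ e ∈ E, P ⊆ e ∧ Disjoint e B

open Classical in
/-- The members of `E` all of whose pairs of vertices are robustly covered by `E`. -/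
noncomputable def robustPart (M : ℕ) (E : Finset (Finset V)) : Finset (Finset V) :=
  {e ∈ E | ∀ P ⊆ e, #P = 2 → RobustlyCovered M E P}

theorem robustPart_subset (M : ℕ) (E : Finset (Finset V)) : robustPart M E ⊆ E := by
  classical
  exact filter_subset _ _

/-- Few edges contain a pair `P` that is not robustly covered: they all meet a fixed set of at most
`M` further vertices, so they contain one of `M` fixed triples. -/
theorem card_sdiff_robustPart_le [Fintype V] [DecidableEq V] {r : ℕ} (h3 : 3 ≤ r) (M : ℕ)
    {E : Finset (Finset V)} (hr : ∀ e ∈ E, #e = r) :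
    #(E \ robustPart M E) ≤ M * Fintype.card V ^ (r - 1) := by
  classical
  set N := Fintype.card V
  have hpair : ∀ P : Finset V, #P = 2 → ¬ RobustlyCovered M E P →
      #{e ∈ E | P ⊆ e} ≤ M * N ^ (r - 3) := by
    intro P hP hbad
    simp only [RobustlyCovered] at hbad
    push Not at hbad
    obtain ⟨B, hBM, hPB, hB⟩ := hbad
    have hsub : {e ∈ E | P ⊆ e} ⊆ B.biUnion fun b => {e ∈ E | insert b P ⊆ e} := by
      intro e he
      obtain ⟨heE, hPe⟩ := mem_filter.1 he
      obtain ⟨b, hbe, hbB⟩ := not_disjoint_iff.1 (hB e heE hPe)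
      exact mem_biUnion.2 ⟨b, hbB, mem_filter.2 ⟨heE, insert_subset hbe hPe⟩⟩
    refine ((card_le_card hsub).trans (card_biUnion_le_card_mul _ _ (N ^ (r - 3)) ?_)).trans
      (Nat.mul_le_mul_right _ hBM)
    intro b hb
    have hcard : #(insert b P) = 3 := by
      rw [card_insert_of_notMem (disjoint_right.1 hPB hb), hP]
    simpa only [hcard] using card_filter_subset_le hr (insert b P)
  have hsub : E \ robustPart M E ⊆
      {P ∈ (univ : Finset V).powersetCard 2 | ¬ RobustlyCovered M E P}.biUnion
        fun P => {e ∈ E | P ⊆ e} := by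
    intro e he
    obtain ⟨heE, hne⟩ := mem_sdiff.1 he
    have : ∃ P ⊆ e, #P = 2 ∧ ¬ RobustlyCovered M E P := by
      by_contra h
      push Not at h
      exact hne (mem_filter.2 ⟨heE, h⟩)
    obtain ⟨P, hPe, hP2, hP⟩ := this
    exact mem_biUnion.2 ⟨P, mem_filter.2 ⟨mem_powersetCard.2 ⟨subset_univ _, hP2⟩, hP⟩,
      mem_filter.2 ⟨heE, hPe⟩⟩
  calc _ ≤ #{P ∈ (univ : Finset V).powersetCard 2 | ¬ RobustlyCovered M E P} *
        (M * N ^ (r - 3)) := by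
        refine (card_le_card hsub).trans (card_biUnion_le_card_mul _ _ _ fun P hP => ?_)
        obtain ⟨hP2, hP⟩ := mem_filter.1 hP
        exact hpair P (mem_powersetCard.1 hP2).2 hP
    _ ≤ N ^ 2 * (M * N ^ (r - 3)) := by
        refine Nat.mul_le_mul_right _ ((card_filter_le _ _).trans ?_)
        rw [card_powersetCard, card_univ]
        exact Nat.choose_le_pow _ _
    _ = M * N ^ (r - 1) := by
        rw [show r - 1 = 2 + (r - 3) by omega, pow_add]
        ring

/-- Robustly covered pairs `P q` extend to edges whose remaining vertices lie outside `Q` and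
are disjoint for distinct indices; the edges are chosen one after the other. -/
theorem exists_disjoint_extensions [DecidableEq V] {ι : Type*} [DecidableEq ι] {M r : ℕ}
    {E : Finset (Finset V)} (hr : ∀ e ∈ E, #e = r) (Q : Finset V) (P : ι → Finset V)
    (hP2 : ∀ q, #(P q) = 2) (hrob : ∀ q, RobustlyCovered M E (P q))
    (S : Finset ι) (hM : #Q + #S * (r - 2) ≤ M) :
    ∃ D : ι → Finset V, ∀ q ∈ S, P q ∪ D q ∈ E ∧ #(D q) = r - 2 ∧ Disjoint (D q) Q ∧
      ∀ q' ∈ S, q ≠ q' → Disjoint (D q) (D q') := by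
  induction S using Finset.induction_on with
  | empty => exact ⟨fun _ => ∅, by simp⟩
  | insert q S hq ih =>
    rw [card_insert_of_notMem hq, Nat.add_mul, one_mul] at hM
    obtain ⟨D, hD⟩ := ih (by omega)
    obtain ⟨e, he, hPe, heB⟩ := hrob q ((Q ∪ S.biUnion D) \ P q) (by
      have h1 : #(S.biUnion D) ≤ #S * (r - 2) :=
        card_biUnion_le_card_mul _ _ _ fun q hq => (hD q hq).2.1.le
      have h2 := card_union_le Q (S.biUnion D)
      have h3 := card_le_card (sdiff_subset (s := Q ∪ S.biUnion D) (t := P q))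
      omega) disjoint_sdiff
    have hnew : Disjoint (e \ P q) (Q ∪ S.biUnion D) := by
      rw [disjoint_left]
      intro w hw hw'
      obtain ⟨hwe, hwP⟩ := mem_sdiff.1 hw
      exact disjoint_left.1 heB hwe (mem_sdiff.2 ⟨hw', hwP⟩)
    rw [disjoint_union_right] at hnew
    have hnewD : ∀ q' ∈ S, Disjoint (e \ P q) (D q') := fun q' hq' =>
      disjoint_of_subset_right (subset_biUnion_of_mem D hq') hnew.2
    have hneq : ∀ q' ∈ S, q' ≠ q := fun q' hq' h => hq (h ▸ hq')
    refine ⟨Function.update D q (e \ P q), fun a ha => ?_⟩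
    rcases mem_insert.1 ha with rfl | haS
    · rw [Function.update_self]
      refine ⟨by rwa [union_sdiff_of_subset hPe], ?_, hnew.1, fun b hb hab => ?_⟩
      · rw [card_sdiff_of_subset hPe, hr e he, hP2]
      · rw [Function.update_of_ne hab.symm]
        exact hnewD b ((mem_insert.1 hb).resolve_left hab.symm)
    · rw [Function.update_of_ne (hneq a haS)]
      obtain ⟨h1, h2, h3, h4⟩ := hD a haS
      refine ⟨h1, h2, h3, fun b hb hab => ?_⟩
      rcases mem_insert.1 hb with rfl | hbS
      · rw [Function.update_self]
        exact (hnewD a haS).symm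
      · rw [Function.update_of_ne (hneq b hbS)]
        exact h4 b hbS hab

/-- If `H` is free of the generalized fan, then no `k + 1` vertices forming a clique of the cover
graph of the robust part contain an edge of it: together they would be the core of a fan. -/
theorem edgeCliqueBounded_robustPart [DecidableEq V] {k r : ℕ} (hr2 : 2 ≤ r) (hrk : r ≤ k + 1)
    {H : RGraph V r} (hfree : Free (generalizedFan r (k + 1) hr2 hrk) H) {M : ℕ}
    (hM : Fintype.card (FanVertex r (k + 1)) ≤ M) :
    EdgeCliqueBounded k (robustPart M H.edges) := by
  classical
  intro e he Q₀ heQ₀ hQ₀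
  by_contra hlt
  have heH : e ∈ H.edges := robustPart_subset _ _ he
  have her := H.card_of_mem e heH
  obtain ⟨Q, heQ, hQQ₀, hQcard⟩ := exists_subsuperset_card_eq heQ₀ (her.trans_le hrk)
    (not_le.1 hlt)
  obtain ⟨x₀, -⟩ : e.Nonempty := card_pos.1 (by omega)
  let a : Fin (k + 1) → V := fun i =>
    if h : (i : ℕ) < r then (e.equivFinOfCardEq her).symm ⟨i, h⟩ else x₀
  have hae : ∀ i : Fin (k + 1), (i : ℕ) < r → a i ∈ e := fun i hi => by
    simp only [a, dif_pos hi]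
    exact coe_mem _
  obtain ⟨g, hg⟩ := Finset.exists_equiv_extend_of_card_eq (α := Fin (k + 1)) (t := Q)
    (by rw [Fintype.card_fin, hQcard]) (s := {i : Fin (k + 1) | (i : ℕ) < r}) (f := a)
    (fun v hv => by
      obtain ⟨i, hi, rfl⟩ := mem_image.1 hv
      exact heQ (hae i (mem_filter.1 hi).2))
    (fun i hi j hj hij => by
      have hi' : (i : ℕ) < r := (mem_filter.1 (mem_coe.1 hi)).2
      have hj' : (j : ℕ) < r := (mem_filter.1 (mem_coe.1 hj)).2
      simp only [a, dif_pos hi', dif_pos hj'] at hij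
      have := (e.equivFinOfCardEq her).symm.injective (Subtype.ext hij)
      exact Fin.ext (Fin.mk.inj this))
  let core : Fin (k + 1) ↪ V := g.toEmbedding.trans (Function.Embedding.subtype _)
  have hcoreQ : ∀ i, core i ∈ Q := fun i => (g i).2
  have hcore : ∀ i : Fin (k + 1), (i : ℕ) < r → core i ∈ e := fun i hi => by
    have h1 : core i = a i := hg i (mem_filter.2 ⟨mem_univ _, hi⟩)
    rw [h1]
    exact hae i hi
  let P : FanPair r (k + 1) → Finset V := fun q => q.1.map core
  have hPQ : ∀ q, P q ⊆ Q := fun q v hv => by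
    obtain ⟨i, -, rfl⟩ := mem_map.1 hv
    exact hcoreQ i
  have hP2 : ∀ q, #(P q) = 2 := fun q => (card_map _).trans q.2.1
  have hrob : ∀ q, RobustlyCovered M H.edges (P q) := by
    intro q
    obtain ⟨u, v, huv, hPq⟩ := card_eq_two.1 (hP2 q)
    have huQ : u ∈ Q := hPQ q (by rw [hPq]; exact mem_insert_self _ _)
    have hvQ : v ∈ Q := hPQ q (by rw [hPq]; exact mem_insert_of_mem (mem_singleton_self _))
    obtain ⟨-, f, hf, hu, hv⟩ := hQ₀ (hQQ₀ huQ) (hQQ₀ hvQ) huv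
    refine (mem_filter.1 hf).2 (P q) ?_ (hP2 q)
    rw [hPq]
    exact insert_subset hu (singleton_subset_iff.2 hv)
  obtain ⟨D, hD⟩ := exists_disjoint_extensions H.card_of_mem Q P hP2 hrob univ (by
    refine le_trans (le_of_eq ?_) hM
    rw [hQcard, card_univ, Fintype.card_sum, Fintype.card_prod, Fintype.card_fin,
      Fintype.card_fin])
  have hDcard : ∀ q, #(D q) = r - 2 := fun q => (hD q (mem_univ q)).2.1
  let priv : FanPair r (k + 1) × Fin (r - 2) → V := fun z =>
    ((D z.1).equivFinOfCardEq (hDcard z.1)).symm z.2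
  have hpriv : ∀ z, priv z ∈ D z.1 := fun z => coe_mem _
  have hprivinj : Function.Injective priv := by
    rintro ⟨q, i⟩ ⟨q', i'⟩ h
    have hqq : q = q' := by
      by_contra hne
      have h1 := hpriv (q, i)
      rw [h] at h1
      exact disjoint_left.1 ((hD q (mem_univ _)).2.2.2 q' (mem_univ _) hne) h1 (hpriv (q', i'))
    subst hqq
    have := ((D q).equivFinOfCardEq (hDcard q)).symm.injective (Subtype.ext h)
    exact congrArg (Prod.mk q) this
  have hinj : Function.Injective (Sum.elim core priv) := by
    refine core.injective.sumElim hprivinj fun i z h => ?_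
    exact disjoint_left.1 (hD z.1 (mem_univ _)).2.2.1 (hpriv z) (h ▸ hcoreQ i)
  refine hfree ⟨⟨Sum.elim core priv, hinj⟩, fun s hs => ?_⟩
  have hscard : #s = r := (generalizedFan r (k + 1) hr2 hrk).card_of_mem s hs
  -- Since all edges have `r` vertices, it is enough that `s` is mapped into an edge of `H`.
  have hmap : ∀ f ∈ H.edges, (∀ w ∈ s, Sum.elim core priv w ∈ f) →
      s.map ⟨Sum.elim core priv, hinj⟩ ∈ H.edges := by
    intro f hf hsf
    rwa [eq_of_subset_of_card_le (s := s.map ⟨Sum.elim core priv, hinj⟩) (t := f)]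
    · intro v hv
      obtain ⟨w, hw, rfl⟩ := mem_map.1 hv
      exact hsf w hw
    · rw [card_map, hscard, H.card_of_mem f hf]
  simp only [generalizedFan] at hs
  rcases mem_insert.1 hs with rfl | hs
  · refine hmap e heH fun w hw => ?_
    rcases mem_disjSum.1 hw with ⟨i, hi, rfl⟩ | ⟨z, hz, -⟩
    · exact hcore i (mem_filter.1 hi).2
    · exact absurd hz (notMem_empty z)
  · obtain ⟨q, -, rfl⟩ := mem_image.1 hs
    refine hmap _ (hD q (mem_univ q)).1 fun w hw => ?_
    rcases mem_disjSum.1 hw with ⟨i, hi, rfl⟩ | ⟨z, hz, rfl⟩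
    · exact mem_union_left _ (mem_map_of_mem core hi)
    · have hzq : z.1 = q := mem_singleton.1 (mem_product.1 hz).1
      exact mem_union_right _ (hzq ▸ hpriv z)

/-! ### From the spectral radius to the number of edges -/

/-- Hölder's inequality compares the polynomial form at `x` with the one at `|x| ^ p`. -/
theorem factorial_mul_sum_prod_le {p : ℝ} (hp : 1 ≤ p) (r : ℕ) (E : Finset (Finset V)) (x : V → ℝ)
    {b : ℝ} (hb : (r ! : ℝ) * ∑ e ∈ E, ∏ v ∈ e, |x v| ^ p ≤ b) :
    (r ! : ℝ) * ∑ e ∈ E, ∏ v ∈ e, |x v| ≤ ((r ! : ℝ) * #E) ^ (1 - 1 / p) * b ^ (1 / p) := by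
  have h := Real.inner_le_weight_mul_Lp_of_nonneg E hp (fun _ => (r ! : ℝ))
    (fun e => ∏ v ∈ e, |x v|) (fun _ => by positivity)
    (fun e => prod_nonneg fun v _ => abs_nonneg _)
  simp only [← mul_sum, sum_const, nsmul_eq_mul] at h
  rw [mul_comm (#E : ℝ), ← one_div] at h
  refine h.trans (mul_le_mul_of_nonneg_left ?_ (by positivity))
  have hpow : ∀ e : Finset V, (∏ v ∈ e, |x v|) ^ p = ∏ v ∈ e, |x v| ^ p := fun e =>
    (Real.finsetProd_rpow e _ (fun v _ => abs_nonneg _) p).symm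
  simp only [hpow]
  refine Real.rpow_le_rpow ?_ hb (by positivity)
  exact mul_nonneg (by positivity)
    (sum_nonneg fun e _ => prod_nonneg fun v _ => Real.rpow_nonneg (abs_nonneg _) _)

theorem factorial_mul_choose_mul_div_pow (k r : ℕ) (t : ℝ) :
    (r ! : ℝ) * (k.choose r * (t / k) ^ r) = (k.descFactorial r : ℝ) / (k : ℝ) ^ r * t ^ r := by
  rw [Nat.descFactorial_eq_factorial_mul_choose, div_pow]
  push_cast
  ring

/-- The part `E` of the edge set contributes to the spectral radius as if it were the whole edge
set, and the remaining edges contribute little if there are few of them. -/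
theorem pSpectralRadius_le [Fintype V] [Nonempty V] [DecidableEq V] {p : ℝ} (hp : 1 ≤ p) {k r : ℕ}
    (H : RGraph V r) {E : Finset (Finset V)} (hEH : E ⊆ H.edges) (hE : EdgeCliqueBounded k E) :
    H.pSpectralRadius p ≤
      ((r ! : ℝ) * #E) ^ (1 - 1 / p) * ((k.descFactorial r : ℝ) / (k : ℝ) ^ r) ^ (1 / p) +
        ((r ! : ℝ) * #(H.edges \ E)) ^ (1 - 1 / p) := by
  obtain ⟨x, hx, hval⟩ := (isGreatest_pSpectralRadius hp H).1
  have hp0 : 0 < p := by linarith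
  have hsum0 : 0 ≤ ∑ v, |x v| ^ p := sum_nonneg fun v _ => Real.rpow_nonneg (abs_nonneg _) _
  have hsum : ∑ v, |x v| ^ p = 1 := by
    have h : (∑ v, |x v| ^ p) ^ (1 / p) = 1 := hx
    exact (Real.rpow_left_inj hsum0 zero_le_one (by positivity)).1 (h.trans (Real.one_rpow _).symm)
  have hx0 : ∀ v, 0 ≤ |x v| ^ p := fun v => Real.rpow_nonneg (abs_nonneg _) _
  have h1 := factorial_mul_sum_prod_le hp r E x
    (b := (k.descFactorial r : ℝ) / (k : ℝ) ^ r) (by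
      have h := hE.sum_prod_le (fun e he => H.card_of_mem e (hEH he)) univ _ hx0
      simp only [subset_univ, filter_true] at h
      refine (mul_le_mul_of_nonneg_left h (Nat.cast_nonneg _)).trans (le_of_eq ?_)
      rw [factorial_mul_choose_mul_div_pow, hsum, one_pow, mul_one])
  have h2 := factorial_mul_sum_prod_le hp r (H.edges \ E) x (b := 1) (by
      have h := sum_powersetCard_prod_le univ _ hx0 r
      have hsub : ∑ e ∈ H.edges \ E, ∏ v ∈ e, |x v| ^ p ≤
          ∑ e ∈ (univ : Finset V).powersetCard r, ∏ v ∈ e, |x v| ^ p :=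
        sum_le_sum_of_subset_of_nonneg (fun e he => mem_powersetCard.2
          ⟨subset_univ _, H.card_of_mem e (mem_sdiff.1 he).1⟩)
          fun e _ _ => prod_nonneg fun v _ => hx0 v
      refine (mul_le_mul_of_nonneg_left (hsub.trans h) (Nat.cast_nonneg _)).trans ?_
      rw [factorial_mul_choose_mul_div_pow, hsum, one_pow, mul_one, card_univ]
      have hV : 0 < Fintype.card V := Fintype.card_pos
      rw [div_le_one (by positivity)]
      exact_mod_cast Nat.descFactorial_le_pow _ _)
  rw [Real.one_rpow, mul_one] at h2
  rw [← hval]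
  calc H.polyForm x ≤ (r ! : ℝ) * ∑ e ∈ H.edges, ∏ v ∈ e, |x v| := by
        refine mul_le_mul_of_nonneg_left (sum_le_sum fun e _ => ?_) (Nat.cast_nonneg _)
        rw [← abs_prod]
        exact le_abs_self _
    _ = (r ! : ℝ) * ∑ e ∈ E, ∏ v ∈ e, |x v| +
          (r ! : ℝ) * ∑ e ∈ H.edges \ E, ∏ v ∈ e, |x v| := by
        rw [← sum_sdiff hEH]; ring
    _ ≤ _ := add_le_add h1 h2

/-- A large spectral radius forces a nearly extremal number of edges in `E`. This is where `1 < p`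
is needed: the number of edges enters with the positive exponent `1 - 1 / p`. -/
theorem card_ge_of_lt_pSpectralRadius {p : ℝ} (hp : 1 < p) {k r n M : ℕ} (hr : 1 ≤ r) (hn : 0 < n)
    (H : RGraph (Fin n) r) {E : Finset (Finset (Fin n))} (hEH : E ⊆ H.edges)
    (hE : EdgeCliqueBounded k E) (hM : #(H.edges \ E) ≤ M * n ^ (r - 1)) {δ δ' τ : ℝ}
    (hδ' : δ' ≤ 1) (hδ : (1 - δ') ^ (1 - 1 / p) ≤ 1 - 2 * δ)
    (hτ : τ ^ (1 - 1 / p) ≤ δ * ((k.descFactorial r : ℝ) / (k : ℝ) ^ r))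
    (hnτ : (r ! : ℝ) * M ≤ τ * n)
    (hspec : (1 - δ) * ((k.descFactorial r : ℝ) / (k : ℝ) ^ r) *
      (n : ℝ) ^ ((r : ℝ) * (1 - 1 / p)) < H.pSpectralRadius p) :
    (1 - δ') * (k.choose r * ((n : ℝ) / k) ^ r) ≤ #E := by
  have : Nonempty (Fin n) := ⟨⟨0, hn⟩⟩
  have hα : 0 < 1 - 1 / p := by
    rw [sub_pos, div_lt_one (by linarith)]; exact hp
  have h1 := hspec.trans_le (pSpectralRadius_le hp.le H hEH hE)
  set α := 1 - 1 / p with hαdef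
  set a : ℝ := (k.descFactorial r : ℝ) / (k : ℝ) ^ r with ha
  have ha0 : 0 ≤ a := by positivity
  have hn0 : (0 : ℝ) < n := by exact_mod_cast hn
  have hτ0 : 0 ≤ τ := by
    by_contra hneg
    have h2 : τ * n < 0 := mul_neg_of_neg_of_pos (not_le.1 hneg) hn0
    have h3 : (0 : ℝ) ≤ (r ! : ℝ) * M := by positivity
    linarith
  rw [Real.rpow_mul hn0.le, Real.rpow_natCast] at h1
  set X : ℝ := (n : ℝ) ^ r with hX
  have hX0 : 0 < X := by positivity
  have h2 : ((r ! : ℝ) * #(H.edges \ E)) ^ α ≤ δ * a * X ^ α := by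
    have h3 : (r ! : ℝ) * #(H.edges \ E) ≤ τ * X := by
      have h4 : (#(H.edges \ E) : ℝ) ≤ M * (n : ℝ) ^ (r - 1) := by exact_mod_cast hM
      calc (r ! : ℝ) * #(H.edges \ E) ≤ r ! * (M * (n : ℝ) ^ (r - 1)) := by gcongr
        _ = (r ! * M) * (n : ℝ) ^ (r - 1) := by ring
        _ ≤ τ * n * (n : ℝ) ^ (r - 1) := by gcongr
        _ = τ * X := by rw [hX, mul_assoc, ← pow_succ', Nat.sub_add_cancel hr]
    refine (Real.rpow_le_rpow (by positivity) h3 hα.le).trans ?_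
    rw [Real.mul_rpow hτ0 hX0.le]
    exact mul_le_mul_of_nonneg_right hτ (by positivity)
  by_contra hlt
  push Not at hlt
  have h3 : (r ! : ℝ) * #E ≤ (1 - δ') * (a * X) := by
    calc (r ! : ℝ) * #E ≤ r ! * ((1 - δ') * (k.choose r * ((n : ℝ) / k) ^ r)) := by gcongr
      _ = (1 - δ') * (r ! * (k.choose r * ((n : ℝ) / k) ^ r)) := by ring
      _ = _ := by rw [factorial_mul_choose_mul_div_pow]
  have h4 : ((r ! : ℝ) * #E) ^ α * a ^ (1 / p) ≤ (1 - 2 * δ) * a * X ^ α := by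
    calc ((r ! : ℝ) * #E) ^ α * a ^ (1 / p)
        ≤ ((1 - δ') * (a * X)) ^ α * a ^ (1 / p) := by
          gcongr
      _ = (1 - δ') ^ α * (a ^ α * a ^ (1 / p)) * X ^ α := by
          rw [Real.mul_rpow (by linarith) (by positivity), Real.mul_rpow ha0 hX0.le]; ring
      _ = (1 - δ') ^ α * a * X ^ α := by
          rw [← Real.rpow_add_of_nonneg ha0 hα.le (by positivity),
            show α + 1 / p = 1 by rw [hαdef]; ring, Real.rpow_one]
      _ ≤ _ := by gcongr
  have h5 : (1 - 2 * δ) * a * X ^ α + δ * a * X ^ α = (1 - δ) * a * X ^ α := by ring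
  linarith

/-! ### Closeness to the Turán hypergraph -/

/-- The `r`-graph of all `r`-sets on which the colouring `c` is injective. -/
def transversalGraph [Fintype V] [DecidableEq V] {k : ℕ} (r : ℕ) (c : V → Fin k) : RGraph V r where
  edges := {e | #e = r ∧ Set.InjOn c e}
  card_of_mem _ he := (mem_filter.1 he).2.1

theorem mem_transversalGraph [Fintype V] [DecidableEq V] {k r : ℕ} {c : V → Fin k}
    {e : Finset V} : e ∈ (transversalGraph r c).edges ↔ #e = r ∧ Set.InjOn c e := by
  simp [transversalGraph]

theorem edgeCliqueBounded_transversalGraph [Fintype V] [DecidableEq V] {k : ℕ} (r : ℕ)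
    (c : V → Fin k) : EdgeCliqueBounded k (transversalGraph r c).edges := by
  intro e _ Q _ hQ
  have hinj : Set.InjOn c Q := by
    intro u hu v hv huv
    by_contra hne
    obtain ⟨-, f, hf, huf, hvf⟩ := hQ hu hv hne
    exact hne ((mem_transversalGraph.1 hf).2 huf hvf huv)
  simpa using card_le_card_of_injOn c (fun _ _ => mem_univ _) hinj

/-- A nearly extremal part `E` of the edge set, with few edges outside `E`, makes `H` close to the
Turán `r`-graph: almost all edges of `E` are transversal to a balanced partition, and comparing
sizes, almost all transversal `r`-sets are in `E`. -/
theorem isCloseToTuran_of_edgeCliqueBounded {k r n M : ℕ} (h3 : 3 ≤ r) (hrk : r ≤ k)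
    (H : RGraph (Fin n) r) {E : Finset (Finset (Fin n))} (hEH : E ⊆ H.edges)
    (hE : EdgeCliqueBounded k E) (hM : #(H.edges \ E) ≤ M * n ^ (r - 1)) {γ : ℝ} (hγ0 : 0 < γ)
    (hγ : 16 * k ^ 3 * γ ≤ 1) (hn : 2 * r ≤ γ * n) (hMn : M ≤ γ * n)
    (hcard : (1 - γ ^ 2) * (k.choose r * ((n : ℝ) / k) ^ r) ≤ #E) :
    H.IsCloseToTuran k (16 * k ^ 3 * γ * (n : ℝ) ^ r) := by
  have hEr : ∀ e ∈ E, #e = r := fun e he => H.card_of_mem e (hEH he)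
  obtain ⟨c, hbal, W, hW, hinj⟩ := hE.exists_balanced_coloring hEr h3 hrk hγ0 hγ hn hcard
  refine ⟨transversalGraph r c, ⟨c, hbal, fun e => mem_transversalGraph⟩, ?_⟩
  set T := transversalGraph r c
  have hnr : (n : ℝ) * (n : ℝ) ^ (r - 1) = (n : ℝ) ^ r := by
    rw [← pow_succ', Nat.sub_add_cancel (by omega)]
  have hk1 : (1 : ℝ) ≤ k ^ 3 := one_le_pow₀ (by exact_mod_cast (by omega : 1 ≤ k))
  have hET : (#(E \ T.edges) : ℝ) ≤ 7 * k ^ 3 * γ * (n : ℝ) ^ r := by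
    have h1 : E \ T.edges ⊆ {e ∈ E | ¬ Disjoint e W} := fun e he => by
      obtain ⟨heE, heT⟩ := mem_sdiff.1 he
      exact mem_filter.2 ⟨heE, fun hd => heT (mem_transversalGraph.2 ⟨hEr e heE, hinj e heE hd⟩)⟩
    have h2 := (card_le_card h1).trans (card_filter_not_disjoint_le hEr W)
    rw [Fintype.card_fin] at h2
    calc (#(E \ T.edges) : ℝ) ≤ #W * (n : ℝ) ^ (r - 1) := by exact_mod_cast h2
      _ ≤ 7 * k ^ 3 * γ * n * (n : ℝ) ^ (r - 1) := by gcongr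
      _ = _ := by rw [mul_assoc, hnr]
  have hHE : (#(H.edges \ E) : ℝ) ≤ γ * (n : ℝ) ^ r := by
    calc (#(H.edges \ E) : ℝ) ≤ M * (n : ℝ) ^ (r - 1) := by exact_mod_cast hM
      _ ≤ γ * n * (n : ℝ) ^ (r - 1) := by gcongr
      _ = _ := by rw [mul_assoc, hnr]
  have hT : (#T.edges : ℝ) ≤ k.choose r * ((n : ℝ) / k) ^ r := by
    have h := (edgeCliqueBounded_transversalGraph r c).card_le T.card_of_mem univ
    simpa using h
  have hTE : (#(T.edges \ E) : ℝ) + #E = #T.edges + #(E \ T.edges) := by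
    have h1 := card_sdiff_add_card T.edges E
    have h2 := card_sdiff_add_card E T.edges
    rw [union_comm] at h2
    exact_mod_cast (show #(T.edges \ E) + #E = #T.edges + #(E \ T.edges) by omega)
  have hchoose : (k.choose r : ℝ) * ((n : ℝ) / k) ^ r ≤ (n : ℝ) ^ r := by
    have h1 : (k.choose r : ℝ) ≤ (k : ℝ) ^ r := by exact_mod_cast Nat.choose_le_pow k r
    have hk0 : (0 : ℝ) < k := by exact_mod_cast (by omega : 0 < k)
    calc (k.choose r : ℝ) * ((n : ℝ) / k) ^ r ≤ (k : ℝ) ^ r * ((n : ℝ) / k) ^ r := by gcongr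
      _ = _ := by rw [← mul_pow, mul_div_cancel₀ _ hk0.ne']
  have hsub : H.edges ∆ T.edges ⊆ (H.edges \ E) ∪ (E \ T.edges) ∪ (T.edges \ E) := by
    intro e he
    rw [mem_symmDiff] at he
    simp only [mem_union, mem_sdiff]
    have := @hEH e
    tauto
  have hsum : (#(H.edges ∆ T.edges) : ℝ) ≤ #(H.edges \ E) + #(E \ T.edges) + #(T.edges \ E) := by
    exact_mod_cast (card_le_card hsub).trans
      ((card_union_le _ _).trans (Nat.add_le_add_right (card_union_le _ _) _))
  have hγ1 : γ ^ 2 * (k.choose r * ((n : ℝ) / k) ^ r) ≤ γ * (n : ℝ) ^ r := by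
    have hγ' : γ ^ 2 ≤ γ := by nlinarith
    calc _ ≤ γ * (k.choose r * ((n : ℝ) / k) ^ r) := by gcongr
      _ ≤ _ := by gcongr
  have hfin : γ * (n : ℝ) ^ r ≤ k ^ 3 * (γ * (n : ℝ) ^ r) :=
    le_mul_of_one_le_left (by positivity) hk1
  linarith

end RGraph

open RGraph in
theorem theorem3p2 (p : ℝ) (hp : 1 < p) (k r : ℕ) (hr : 3 ≤ r) (hrk : r ≤ k)
    (ε : ℝ) (hε : 0 < ε) :
    ∃ δ : ℝ, 0 < δ ∧ ∃ n₀ : ℕ, ∀ n : ℕ, n₀ < n → ∀ H : RGraph (Fin n) r,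
      RGraph.Free
        (RGraph.generalizedFan r (k + 1) (le_trans (by norm_num) hr) (Nat.le_succ_of_le hrk)) H →
      (1 - δ) * ((k.descFactorial r : ℝ) / (k : ℝ) ^ r) * (n : ℝ) ^ ((r : ℝ) * (1 - 1 / p)) <
        H.pSpectralRadius p →
      H.IsCloseToTuran k (ε * (n.choose r : ℝ)) := by
  have hα : 0 < 1 - 1 / p := by
    rw [sub_pos, div_lt_one (by linarith)]; exact hp
  have hk0 : (0 : ℝ) < k := by exact_mod_cast (by omega : 0 < k)
  have hk1 : (1 : ℝ) ≤ k ^ 3 := one_le_pow₀ (by exact_mod_cast (by omega : 1 ≤ k))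
  have ha : 0 < (k.descFactorial r : ℝ) / (k : ℝ) ^ r := by
    have : 0 < k.descFactorial r := Nat.descFactorial_pos.2 hrk
    positivity
  obtain ⟨γ, hγ0, hγ, hγε⟩ : ∃ γ : ℝ, 0 < γ ∧ 16 * k ^ 3 * γ ≤ 1 ∧
      16 * k ^ 3 * γ * (2 ^ r * r !) ≤ ε := by
    refine ⟨min (1 / (16 * k ^ 3)) (ε / (16 * k ^ 3 * (2 ^ r * r !))), by positivity, ?_, ?_⟩
    · calc _ ≤ 16 * (k : ℝ) ^ 3 * (1 / (16 * k ^ 3)) := by gcongr; exact min_le_left _ _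
        _ = 1 := by field_simp
    · calc _ ≤ 16 * (k : ℝ) ^ 3 * (ε / (16 * k ^ 3 * (2 ^ r * r !))) * (2 ^ r * r !) := by
            gcongr; exact min_le_right _ _
        _ = ε := by field_simp
  have hγ1 : γ < 1 := by nlinarith
  have hγsq : γ ^ 2 < 1 := by nlinarith
  -- With this `δ` the loss `2 * δ` in the spectral radius becomes a loss `γ ^ 2` in the edge count.
  obtain ⟨δ, hδ⟩ : ∃ δ, δ = (1 - (1 - γ ^ 2) ^ (1 - 1 / p)) / 2 := ⟨_, rfl⟩
  have hδ0 : 0 < δ := by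
    have := Real.rpow_lt_one (x := 1 - γ ^ 2) (by linarith) (by nlinarith) hα
    rw [hδ]; linarith
  obtain ⟨τ, hτ⟩ : ∃ τ, τ = (δ * ((k.descFactorial r : ℝ) / (k : ℝ) ^ r)) ^ (1 - 1 / p)⁻¹ :=
    ⟨_, rfl⟩
  have hτ0 : 0 < τ := by rw [hτ]; positivity
  have hτα : τ ^ (1 - 1 / p) = δ * ((k.descFactorial r : ℝ) / (k : ℝ) ^ r) := by
    rw [hτ, Real.rpow_inv_rpow (by positivity) hα.ne']
  set M := Fintype.card (FanVertex r (k + 1)) with hMdef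
  refine ⟨δ, hδ0, ⌈(2 * r + M) / γ + r ! * M / τ⌉₊, fun n hn H hfree hspec => ?_⟩
  have hn' : (2 * r + M) / γ + r ! * M / τ < (n : ℝ) := Nat.lt_of_ceil_lt hn
  have hn1 : (2 * r + M : ℝ) ≤ γ * n := by
    rw [← div_le_iff₀' hγ0]
    have : (0 : ℝ) ≤ r ! * M / τ := by positivity
    linarith
  have hn2 : (r ! : ℝ) * M ≤ τ * n := by
    rw [← div_le_iff₀' hτ0]
    have : (0 : ℝ) ≤ (2 * r + M) / γ := by positivity
    linarith
  have hn0 : 0 < n := by omega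
  have hM0 : (0 : ℝ) ≤ M := Nat.cast_nonneg M
  have hr0 : (0 : ℝ) ≤ r := Nat.cast_nonneg r
  have hEH := robustPart_subset M H.edges
  have hE := edgeCliqueBounded_robustPart _ _ hfree hMdef.ge
  have hHE := card_sdiff_robustPart_le hr M H.card_of_mem
  rw [Fintype.card_fin] at hHE
  have hcard := card_ge_of_lt_pSpectralRadius hp (by omega) hn0 H hEH hE hHE (δ' := γ ^ 2)
    hγsq.le (by rw [hδ]; linarith) hτα.le hn2 hspec
  obtain ⟨T, hT, hclose⟩ := isCloseToTuran_of_edgeCliqueBounded hr hrk H hEH hE hHE hγ0 hγ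
    (by linarith) (by linarith) hcard
  refine ⟨T, hT, hclose.trans ?_⟩
  have h2r : 2 * r ≤ n := by
    have : (2 * r : ℝ) ≤ n := by
      have : γ * n ≤ 1 * n := by gcongr
      linarith
    exact_mod_cast this
  have hchoose : ((n : ℝ) / 2) ^ r / r ! ≤ n.choose r := by
    refine le_trans ?_ (Nat.pow_le_choose r n)
    gcongr
    have : n ≤ 2 * (n + 1 - r) := by omega
    have : (n : ℝ) ≤ 2 * (n + 1 - r : ℕ) := by exact_mod_cast this
    linarith
  calc 16 * (k : ℝ) ^ 3 * γ * (n : ℝ) ^ r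
      = 16 * k ^ 3 * γ * (2 ^ r * r !) * (((n : ℝ) / 2) ^ r / r !) := by
        rw [div_pow]; field_simp
    _ ≤ ε * n.choose r := by gcongr
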